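/- Let $\Sigma\subset\mathbb R^2$ be a domain (non-empty, open, connected) with coordinates $(u,v)$, and let $X:\Sigma\to\mathbb R^3$ be a smooth conformally immersed minimal surface with smooth unit normal field $N$, whose image is not contained in a plane. Assume that $(u,v)$ are isothermic coordinates, i.e. conformal, $ds^2=e^{2\omega}(du^2+dv^2)$, and such that the coordinate lines are curvature lines. Let $Q=\frac14\langle X_{uu}-2iX_{uv}-X_{vv},N\rangle$ be the Hopf differential. For $\alpha,\beta\in\mathbb R$ put $$f(u)=\begin{cases}\dfrac{\alpha}{\sqrt{\alpha^2-\beta^2}}\sinh\bigl(\sqrt{\alpha^2-\beta^2}\,u\bigr),&\alpha^2\ne\beta^2\\ \alpha u,&\alpha^2=\beta^2\end{cases}\qquad g(v)=\begin{cases}\dfrac{\beta}{\sqrt{\beta^2-\alpha^2}}\sinh\bigl(\sqrt{\beta^2-\alpha^2}\,v\bigr),&\alpha^2\neq\beta^2\\ \beta v,&\alpha^2=\beta^2\end{cases}$$ (for an imaginary square root, $\frac{1}{i\lambda}\sinh(i\lambda x)=\frac1\lambda\sin(\lambda x)$, so both functions are real), and $$F_{\alpha,\beta}(u,v)=\frac{1+f(u)^2+g(v)^2}{f_u(u)+g_v(v)}.$$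 (1) $Q$ is a non-zero real constant (so that, after rescaling the coordinates and choosing the sign of $N$, it can be normalized to $Q=-\frac12$). (2) Suppose $Q=-\frac12$. Then $X$ has planar curvature lines (every curvature line, i.e. the image of every segment of a coordinate line contained in $\Sigma$, lies in a plane) if and only if, up to a shift of the parameters, $e^\omega$ is one of the functions $F_{\alpha,\beta}$: there are $\alpha,\beta,u_0,v_0\in\mathbb R$ with $\alpha+\beta>0$ such that $e^{\omega(u,v)}=F_{\alpha,\beta}(u-u_0,v-v_0)$ for all $(u,v)\in\Sigma$. (3) For all $\alpha,\beta,u_0,v_0\in\mathbb R$ with $\alpha+\beta>0$ one has $f_u+g_v>0$ on $\mathbb R^2$, and there is a real-analytic $\Omega:\mathbb R^2\to\mathbb R$ with $e^{\Omega(u,v)}=F_{\alpha,\beta}(u-u_0,v-v_0)$ on $\mathbb R^2$; it extends $\omega$ whenever $\omega$ has the form in (2) with these parameters. It has the following properties: - if $\alpha>|\beta|$ and $\beta\neq0$, then $\Omega$ is not periodic in the $u$-direction (not on any line $v=\text{const}$), but periodic in the $v$-direction (with a common period for all $u$) and non-constant in $v$ on every line $u=\text{const}$; - if $\alpha>0$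 and $\beta=0$, then $\Omega$ is not periodic in the $u$-direction and is constant in the $v$-direction; - if $\alpha=\beta$ (hence both are positive), then $\Omega$ is periodic neither in the $u$-direction (on any line $v=\text{const}$) nor in the $v$-direction (on any line $u=\text{const}$); - if $\beta>|\alpha|$, the first two statements hold with the roles of $u$ and $v$ interchanged, for $\alpha\neq0$ and for $\alpha=0$ respectively. -/

import Mathlib

open scoped RealInnerProductSpace

/-- Euclidean three-space. -/
abbrev E3 : Type := EuclideanSpace ℝ (Fin 3)

/-- The partial derivative in the first coordinate `u`. -/
noncomputable def pu (Y : ℝ × ℝ → E3) (p : ℝ × ℝ) : E3 := fderiv ℝ Y p (1, 0)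

/-- The partial derivative in the second coordinate `v`. -/
noncomputable def pv (Y : ℝ × ℝ → E3) (p : ℝ × ℝ) : E3 := fderiv ℝ Y p (0, 1)

/-- `H = ⟨X_uu + X_vv, N⟩ / (2 e^{2ω})`, the mean curvature in conformal coordinates. -/
noncomputable def meanCurv (X N : ℝ × ℝ → E3) (ω : ℝ × ℝ → ℝ) (p : ℝ × ℝ) : ℝ :=
  1 / (2 * Real.exp (2 * ω p)) * ⟪pu (pu X) p + pv (pv X) p, N p⟫

/-- `Q = ⟨X_uu - 2 i X_uv - X_vv, N⟩ / 4` (complex bilinear pairing), the Hopf differential. -/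
noncomputable def hopf (X N : ℝ × ℝ → E3) (p : ℝ × ℝ) : ℂ :=
  (1 / 4 : ℂ) * (((⟪pu (pu X) p, N p⟫ : ℝ) : ℂ)
    - 2 * Complex.I * ((⟪pv (pu X) p, N p⟫ : ℝ) : ℂ) - ((⟪pv (pv X) p, N p⟫ : ℝ) : ℂ))

/-- `X` is a (smooth, conformally immersed) minimal surface over the domain `U` with smooth unit
normal field `N`, and the coordinates `(u, v)` of `U` are isothermic, that is, conformal with
metric `e^{2ω} (du² + dv²)`, and curvature line coordinates. -/
structure IsIsothermicMinimal (U : Set (ℝ × ℝ)) (X N : ℝ × ℝ → E3) (ω : ℝ × ℝ → ℝ) : Prop where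
  isOpen : IsOpen U
  isConnected : IsConnected U
  smooth : ContDiffOn ℝ ((⊤ : ℕ∞) : WithTop ℕ∞) X U
  smooth_normal : ContDiffOn ℝ ((⊤ : ℕ∞) : WithTop ℕ∞) N U
  /-- The first fundamental form is `e^{2ω} (du² + dv²)`. -/
  metric_uu : ∀ p ∈ U, ⟪pu X p, pu X p⟫ = Real.exp (2 * ω p)
  metric_vv : ∀ p ∈ U, ⟪pv X p, pv X p⟫ = Real.exp (2 * ω p)
  metric_uv : ∀ p ∈ U, ⟪pu X p, pv X p⟫ = 0
  /-- `N` is a unit normal field. -/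
  norm_normal : ∀ p ∈ U, ‖N p‖ = 1
  normal_u : ∀ p ∈ U, ⟪N p, pu X p⟫ = 0
  normal_v : ∀ p ∈ U, ⟪N p, pv X p⟫ = 0
  /-- The coordinate directions are principal directions. -/
  principal_u : ∀ p ∈ U, ∃ k : ℝ, pu N p = -k • pu X p
  principal_v : ∀ p ∈ U, ∃ k : ℝ, pv N p = -k • pv X p
  /-- Minimality. -/
  minimal : ∀ p ∈ U, meanCurv X N ω p = 0

/-- In curvature line coordinates the curvature lines are the images of the connected pieces of the
coordinate lines inside `U`; each of them lies in a plane. -/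
def HasPlanarCurvatureLines (U : Set (ℝ × ℝ)) (X : ℝ × ℝ → E3) : Prop :=
  (∀ (v : ℝ) (I : Set ℝ), I.OrdConnected → (∀ u ∈ I, (u, v) ∈ U) →
    Coplanar ℝ ((fun u => X (u, v)) '' I)) ∧
  (∀ (u : ℝ) (J : Set ℝ), J.OrdConnected → (∀ v ∈ J, (u, v) ∈ U) →
    Coplanar ℝ ((fun v => X (u, v)) '' J))

/-- The function `α / √(α² - β²) · sinh (√(α² - β²) x)`, and `α x` if `α² = β²`. For `α² < β²`,
where the square root is imaginary, it is written through the sine. -/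
noncomputable def profile (α β x : ℝ) : ℝ :=
  if β ^ 2 < α ^ 2 then α / √(α ^ 2 - β ^ 2) * Real.sinh (√(α ^ 2 - β ^ 2) * x)
  else if α ^ 2 < β ^ 2 then α / √(β ^ 2 - α ^ 2) * Real.sin (√(β ^ 2 - α ^ 2) * x)
  else α * x

/-- `profile` is the formula with the complex square root `s` of `α² - β²` (either choice). -/
theorem profile_eq_complex_sinh (α β x : ℝ) (s : ℂ) (hs : s ^ 2 = (α : ℂ) ^ 2 - (β : ℂ) ^ 2)
    (h0 : α ^ 2 ≠ β ^ 2) :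
    (profile α β x : ℂ) = (α : ℂ) / s * Complex.sinh (s * x) := by
  have key : ∀ t : ℂ, t ^ 2 = s ^ 2 →
      (α : ℂ) / t * Complex.sinh (t * x) = (α : ℂ) / s * Complex.sinh (s * x) := by
    intro t ht
    rcases sq_eq_sq_iff_eq_or_eq_neg.mp ht with rfl | rfl
    · rfl
    · rw [neg_mul, Complex.sinh_neg, div_neg, neg_mul_neg]
  unfold profile
  rcases lt_or_gt_of_ne h0 with h | h
  · rw [if_neg (not_lt.mpr h.le), if_pos h]
    have hr : ((√(β ^ 2 - α ^ 2) : ℝ) : ℂ) ^ 2 = (β : ℂ) ^ 2 - (α : ℂ) ^ 2 := by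
      rw [← Complex.ofReal_pow, Real.sq_sqrt (by linarith)]; push_cast; ring
    rw [← key (((√(β ^ 2 - α ^ 2) : ℝ) : ℂ) * Complex.I)
      (by rw [mul_pow, hr, hs, Complex.I_sq]; ring)]
    have hne : ((√(β ^ 2 - α ^ 2) : ℝ) : ℂ) ≠ 0 := by
      exact_mod_cast (Real.sqrt_pos.mpr (by linarith)).ne'
    rw [mul_right_comm, Complex.sinh_mul_I]
    push_cast
    field_simp
  · rw [if_pos h]
    have hr : ((√(α ^ 2 - β ^ 2) : ℝ) : ℂ) ^ 2 = s ^ 2 := by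
      rw [← Complex.ofReal_pow, Real.sq_sqrt (by linarith), hs]; push_cast; ring
    rw [← key _ hr]
    push_cast
    rfl

/-- The denominator `f_u (u) + g_v (v)` with `f = profile α β` and `g = profile β α`. -/
noncomputable def metricDen (α β u v : ℝ) : ℝ :=
  deriv (profile α β) u + deriv (profile β α) v

/-- `(1 + f(u)² + g(v)²) / (f_u(u) + g_v(v))` with `f = profile α β` and `g = profile β α`. -/
noncomputable def metricFn (α β u v : ℝ) : ℝ :=
  (1 + profile α β u ^ 2 + profile β α v ^ 2) / metricDen α β u v

/-- On no line `v = const` is the function periodic in `u`. -/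
def NotPeriodicU (Ω : ℝ × ℝ → ℝ) : Prop :=
  ∀ v T : ℝ, T ≠ 0 → ¬ Function.Periodic (fun u => Ω (u, v)) T

/-- On no line `u = const` is the function periodic in `v`. -/
def NotPeriodicV (Ω : ℝ × ℝ → ℝ) : Prop :=
  ∀ u T : ℝ, T ≠ 0 → ¬ Function.Periodic (fun v => Ω (u, v)) T

/-- The function is periodic in `u`, and constant on no line `v = const`. -/
def ProperlyPeriodicU (Ω : ℝ × ℝ → ℝ) : Prop :=
  (∃ T : ℝ, 0 < T ∧ ∀ v, Function.Periodic (fun u => Ω (u, v)) T) ∧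
    ∀ v, ∃ u u', Ω (u, v) ≠ Ω (u', v)

/-- The function is periodic in `v`, and constant on no line `u = const`. -/
def ProperlyPeriodicV (Ω : ℝ × ℝ → ℝ) : Prop :=
  (∃ T : ℝ, 0 < T ∧ ∀ u, Function.Periodic (fun v => Ω (u, v)) T) ∧
    ∀ u, ∃ v v', Ω (u, v) ≠ Ω (u, v')

/-- The function does not depend on `u`. -/
def ConstantU (Ω : ℝ × ℝ → ℝ) : Prop := ∀ u u' v, Ω (u, v) = Ω (u', v)

/-- The function does not depend on `v`. -/
def ConstantV (Ω : ℝ × ℝ → ℝ) : Prop := ∀ u v v', Ω (u, v) = Ω (u, v')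

/-! Write `r` for `e^ω` and `L = ⟨X_uu, N⟩`. Minimality and principal coordinates make the second
fundamental form `L (du² - dv²)`, so `Q = L / 2`, and the Codazzi equations say that both partial
derivatives of `L` vanish. If `L = 0`, then `N` is constant and the surface is planar. Hence `L` is
a non-zero constant.

For `Q = -1/2` one has `L = -1`, and the Gauss equation becomes `r (r_uu + r_vv) = 1 + r_u² + r_v²`.
Planarity of the `u`-lines is equivalent to `r_uv = 0`: the `u`-derivative of `r⁻¹ X_v + L r_v N` is
a multiple of `r_uv`, and this vector is the normal of the plane (`coplanar_of_dd_eq_zero`,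
`dd_eq_zero_of_coplanar`). The condition is symmetric in `u` and `v`, so it governs both families.

If `r_uv = 0`, then `f = r_u` depends on `u` alone and `g = r_v` on `v` alone. Differentiating the
Gauss equation shows that `(f_u - g_v) / r` is a constant `c`, whence `f'' = c f` and `g'' = -c g`.
The first integrals `f'² - c f²` and `g'² + c g²` differ by `c`; they are non-negative and serve as
`α²` and `β²`. The Gauss equation then returns `r = (1 + f² + g²) / (f_u + g_v)`
(`exists_eq_metricFn`).

Conversely, the partial derivatives of `metricFn α β` are `f` and `g` themselves
(`hasDerivAt_metricFn_left`). This gives `r_uv = 0`, and it also decides periodicity: `f` is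
hyperbolic or linear with a single zero if `α² ≥ β²` and `α ≠ 0`, trigonometric if `α² < β²` and `α
≠ 0`, and zero if `α = 0`. -/

open scoped RealInnerProductSpace

/-! ### Calculus of derivatives in constant directions. -/

section DirectionalDerivative

variable {W : Type*} [NormedAddCommGroup W] [NormedSpace ℝ W] {U : Set (ℝ × ℝ)}

/-- The directional derivative of `Y` in the constant direction `e`. -/
noncomputable def dd (e : ℝ × ℝ) (Y : ℝ × ℝ → W) (p : ℝ × ℝ) : W := fderiv ℝ Y p e

/-- Smoothness on a set. -/
def Smooth (U : Set (ℝ × ℝ)) (Y : ℝ × ℝ → W) : Prop :=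
  ContDiffOn ℝ ((⊤ : ℕ∞) : WithTop ℕ∞) Y U

theorem Smooth.differentiableAt {Y : ℝ × ℝ → W} (hY : Smooth U Y) (hU : IsOpen U) {p : ℝ × ℝ}
    (hp : p ∈ U) : DifferentiableAt ℝ Y p :=
  (ContDiffOn.contDiffAt hY (hU.mem_nhds hp)).differentiableAt (by simp)

theorem Smooth.dd {Y : ℝ × ℝ → W} (hY : Smooth U Y) (hU : IsOpen U) (e : ℝ × ℝ) :
    Smooth U (dd e Y) :=
  (ContDiffOn.fderiv_of_isOpen hY hU (by simp)).clm_apply contDiffOn_const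

theorem dd_comm {Y : ℝ × ℝ → W} (hY : Smooth U Y) (hU : IsOpen U) (e e' : ℝ × ℝ) {p : ℝ × ℝ}
    (hp : p ∈ U) : dd e (dd e' Y) p = dd e' (dd e Y) p := by
  have hc : ContDiffAt ℝ ((⊤ : ℕ∞) : WithTop ℕ∞) Y p := ContDiffOn.contDiffAt hY (hU.mem_nhds hp)
  have hs : IsSymmSndFDerivAt ℝ Y p := hc.isSymmSndFDerivAt
    (by simpa using (WithTop.coe_le_coe.mpr le_top : ((2 : ℕ∞) : WithTop ℕ∞) ≤ ((⊤ : ℕ∞) : WithTop ℕ∞)))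
  have hd : DifferentiableAt ℝ (fderiv ℝ Y) p :=
    (hc.fderiv_right (m := 1) (WithTop.coe_le_coe.mpr le_top)).differentiableAt (by simp)
  have key : ∀ a b : ℝ × ℝ, _root_.dd a (_root_.dd b Y) p = fderiv ℝ (fderiv ℝ Y) p a b := by
    intro a b
    have : HasFDerivAt (fun q => fderiv ℝ Y q b) ((fderiv ℝ (fderiv ℝ Y) p).flip b) p := by
      simpa using hd.hasFDerivAt.clm_apply (hasFDerivAt_const b p)
    change fderiv ℝ (fun q => fderiv ℝ Y q b) p a = _
    rw [this.fderiv]; rfl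
  rw [key, key, hs.eq]

theorem dd_congr {Y Z : ℝ × ℝ → W} (hU : IsOpen U) (h : ∀ q ∈ U, Y q = Z q) (e : ℝ × ℝ)
    {p : ℝ × ℝ} (hp : p ∈ U) : dd e Y p = dd e Z p := by
  have : Y =ᶠ[nhds p] Z := Filter.eventually_of_mem (hU.mem_nhds hp) h
  simp only [dd, this.fderiv_eq]

theorem dd_const (e : ℝ × ℝ) (w : W) (p : ℝ × ℝ) : dd e (fun _ => w) p = 0 := by
  simp [dd]

theorem dd_eq_zero_of_const {Y : ℝ × ℝ → W} (hU : IsOpen U) {w : W} (h : ∀ q ∈ U, Y q = w)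
    (e : ℝ × ℝ) {p : ℝ × ℝ} (hp : p ∈ U) : dd e Y p = 0 := by
  rw [dd_congr hU h e hp, dd_const]

theorem dd_add {Y Z : ℝ × ℝ → W} {e p : ℝ × ℝ} (hY : DifferentiableAt ℝ Y p)
    (hZ : DifferentiableAt ℝ Z p) : dd e (fun q => Y q + Z q) p = dd e Y p + dd e Z p := by
  simp only [dd, fderiv_fun_add hY hZ]; rfl

theorem dd_sub {Y Z : ℝ × ℝ → W} {e p : ℝ × ℝ} (hY : DifferentiableAt ℝ Y p)
    (hZ : DifferentiableAt ℝ Z p) : dd e (fun q => Y q - Z q) p = dd e Y p - dd e Z p := by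
  simp only [dd, fderiv_fun_sub hY hZ]; rfl

theorem dd_smul {s : ℝ × ℝ → ℝ} {Y : ℝ × ℝ → W} {e p : ℝ × ℝ} (hs : DifferentiableAt ℝ s p)
    (hY : DifferentiableAt ℝ Y p) :
    dd e (fun q => s q • Y q) p = s p • dd e Y p + dd e s p • Y p := by
  simp only [dd, fderiv_fun_smul hs hY]; rfl

theorem dd_mul {s t : ℝ × ℝ → ℝ} {e p : ℝ × ℝ} (hs : DifferentiableAt ℝ s p)
    (ht : DifferentiableAt ℝ t p) :
    dd e (fun q => s q * t q) p = s p * dd e t p + t p * dd e s p := by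
  simp only [dd, fderiv_fun_mul hs ht]; rfl

theorem dd_sq {s : ℝ × ℝ → ℝ} {e p : ℝ × ℝ} (hs : DifferentiableAt ℝ s p) :
    dd e (fun q => s q ^ 2) p = 2 * s p * dd e s p := by
  simp only [pow_two]
  rw [dd_mul hs hs]; ring

theorem dd_const_mul {s : ℝ × ℝ → ℝ} {e p : ℝ × ℝ} (a : ℝ) (hs : DifferentiableAt ℝ s p) :
    dd e (fun q => a * s q) p = a * dd e s p := by
  rw [dd_mul (differentiableAt_const a) hs, dd_const]; ring

theorem dd_inv {s : ℝ × ℝ → ℝ} {e p : ℝ × ℝ} (hs : DifferentiableAt ℝ s p) (h : s p ≠ 0) :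
    dd e (fun q => (s q)⁻¹) p = -dd e s p / s p ^ 2 := by
  have := (hasDerivAt_inv h).comp_hasFDerivAt p hs.hasFDerivAt
  have h2 : fderiv ℝ (fun q => (s q)⁻¹) p = _ := this.fderiv
  simp only [dd, h2]
  simp
  field_simp

theorem dd_inner {Y Z : ℝ × ℝ → E3} {e p : ℝ × ℝ} (hY : DifferentiableAt ℝ Y p)
    (hZ : DifferentiableAt ℝ Z p) :
    dd e (fun q => ⟪Y q, Z q⟫) p = ⟪Y p, dd e Z p⟫ + ⟪dd e Y p, Z p⟫ :=
  fderiv_inner_apply ℝ hY hZ e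

/-- A function on a line parallel to the direction `e` whose derivative in this direction vanishes
is constant. -/
theorem eq_of_dd_eq_zero_on_line {Y : ℝ × ℝ → W} {e p : ℝ × ℝ} {I : Set ℝ} (hI : I.OrdConnected)
    (hd : ∀ t ∈ I, DifferentiableAt ℝ Y (p + t • e)) (h0 : ∀ t ∈ I, dd e Y (p + t • e) = 0)
    {s t : ℝ} (hs : s ∈ I) (ht : t ∈ I) : Y (p + s • e) = Y (p + t • e) := by
  have key : ∀ s ∈ I, ∀ t ∈ I, s ≤ t → Y (p + t • e) = Y (p + s • e) := by
    intro s hs t ht hst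
    have hder : ∀ x ∈ Set.Icc s t, HasDerivAt (fun x => Y (p + x • e)) 0 x := by
      intro x hx
      have hxI := hI.out hs ht hx
      have hline : HasDerivAt (fun x : ℝ => p + x • e) e x := by
        simpa using ((hasDerivAt_id x).smul_const e).const_add p
      have := (hd x hxI).hasFDerivAt.comp_hasDerivAt x hline
      have h2 := h0 x hxI
      rw [dd] at h2
      rwa [h2] at this
    exact constant_of_has_deriv_right_zero
      (fun x hx => (hder x hx).continuousAt.continuousWithinAt)
      (fun x hx => (hder x ⟨hx.1, hx.2.le⟩).hasDerivWithinAt) t ⟨hst, le_rfl⟩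
  rcases le_total s t with h | h
  · exact (key s hs t ht h).symm
  · exact key t ht s hs h

theorem eq_of_partials_eq_zero {Y : ℝ × ℝ → W} (hU : IsOpen U) (hc : IsPreconnected U)
    (hY : Smooth U Y) (hu : ∀ p ∈ U, dd (1, 0) Y p = 0) (hv : ∀ p ∈ U, dd (0, 1) Y p = 0)
    {p q : ℝ × ℝ} (hp : p ∈ U) (hq : q ∈ U) : Y p = Y q := by
  refine hU.is_const_of_fderiv_eq_zero (𝕜 := ℝ) hc
    (fun x hx => (hY.differentiableAt hU hx).differentiableWithinAt) ?_ hp hq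
  intro x hx
  ext
  · simpa [dd] using hu x hx
  · simpa [dd] using hv x hx

end DirectionalDerivative

/-! ### Coplanarity through a normal vector, and orthogonal frames. -/

section Coplanar

theorem coplanar_of_inner_eq {s : Set E3} {n : E3} (hn : n ≠ 0)
    (h : ∀ x ∈ s, ∀ y ∈ s, ⟪n, x - y⟫ = 0) : Coplanar ℝ s := by
  have hle : vectorSpan ℝ s ≤ (ℝ ∙ n)ᗮ := by
    rw [vectorSpan_def, Submodule.span_le]
    rintro _ ⟨x, hx, y, hy, rfl⟩
    exact Submodule.mem_orthogonal_singleton_iff_inner_right.mpr (h x hx y hy)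
  have : Fact (Module.finrank ℝ E3 = 2 + 1) := ⟨by simp⟩
  have h2 : Module.finrank ℝ (ℝ ∙ n)ᗮ = 2 := Submodule.finrank_orthogonal_span_singleton hn
  unfold Coplanar
  calc Module.rank ℝ (vectorSpan ℝ s) ≤ Module.rank ℝ (ℝ ∙ n)ᗮ := Submodule.rank_mono hle
    _ = 2 := by rw [← Module.finrank_eq_rank, h2]; rfl

theorem Coplanar.exists_inner_eq_zero {s : Set E3} (h : Coplanar ℝ s) :
    ∃ n : E3, n ≠ 0 ∧ ∀ x ∈ s, ∀ y ∈ s, ⟪n, x - y⟫ = 0 := by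
  have hne : vectorSpan ℝ s ≠ ⊤ := by
    intro ht
    have h2 := h.finrank_le_two
    rw [ht, finrank_top] at h2
    simp at h2
  obtain ⟨n, hn, hn0⟩ := (Submodule.ne_bot_iff _).mp
    (fun hb => hne (Submodule.orthogonal_eq_bot_iff.mp hb))
  refine ⟨n, hn0, fun x hx y hy => ?_⟩
  exact (Submodule.mem_orthogonal' _ n).mp hn _ (vsub_mem_vectorSpan ℝ hx hy)

/-- Parseval's identity for an orthogonal frame of two vectors of length `r` and a unit vector. -/
theorem inner_eq_of_orthogonal_frame {a b n : E3} {r : ℝ} (hr : r ≠ 0) (haa : ⟪a, a⟫ = r ^ 2)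
    (hbb : ⟪b, b⟫ = r ^ 2) (hab : ⟪a, b⟫ = 0) (hnn : ‖n‖ = 1) (hna : ⟪n, a⟫ = 0)
    (hnb : ⟪n, b⟫ = 0) (x y : E3) :
    r ^ 2 * ⟪x, y⟫ = ⟪x, a⟫ * ⟪y, a⟫ + ⟪x, b⟫ * ⟪y, b⟫ + r ^ 2 * (⟪x, n⟫ * ⟪y, n⟫) := by
  have hnn' : ⟪n, n⟫ = 1 := by rw [real_inner_self_eq_norm_sq, hnn]; norm_num
  let w : Fin 3 → E3 := ![r⁻¹ • a, r⁻¹ • b, n]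
  have hw : Orthonormal ℝ w := by
    rw [orthonormal_iff_ite]
    intro i j
    have hba : ⟪b, a⟫ = 0 := by rw [real_inner_comm, hab]
    have han : ⟪a, n⟫ = 0 := by rw [real_inner_comm, hna]
    have hbn : ⟪b, n⟫ = 0 := by rw [real_inner_comm, hnb]
    fin_cases i <;> fin_cases j <;>
      simp [w, inner_smul_left, inner_smul_right, hab, hba, han, hna, hnb, hbn, hnn', haa, hbb,
        -inner_self_eq_norm_sq_to_K] <;>
      field_simp
  let B := basisOfOrthonormalOfCardEqFinrank hw (by simp)
  have hB : ⇑B = w := coe_basisOfOrthonormalOfCardEqFinrank hw (by simp)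
  let O := B.toOrthonormalBasis (by rw [hB]; exact hw)
  have hO : ⇑O = w := by rw [Module.Basis.coe_toOrthonormalBasis, hB]
  have := O.sum_inner_mul_inner x y
  rw [hO, Fin.sum_univ_three] at this
  simp only [w, Matrix.cons_val_zero, Matrix.cons_val_one, Matrix.cons_val,
    inner_smul_left, inner_smul_right] at this
  rw [← this, real_inner_comm y a, real_inner_comm y b, real_inner_comm y n]
  simp
  field_simp

theorem eq_of_inner_frame {a b n : E3} {r : ℝ} (hr : r ≠ 0) (haa : ⟪a, a⟫ = r ^ 2)
    (hbb : ⟪b, b⟫ = r ^ 2) (hab : ⟪a, b⟫ = 0) (hnn : ‖n‖ = 1) (hna : ⟪n, a⟫ = 0)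
    (hnb : ⟪n, b⟫ = 0) {x : E3} (hxa : ⟪x, a⟫ = 0) (hxb : ⟪x, b⟫ = 0) (hxn : ⟪x, n⟫ = 0) :
    x = 0 := by
  have := inner_eq_of_orthogonal_frame hr haa hbb hab hnn hna hnb x x
  rw [hxa, hxb, hxn] at this
  have h2 : r ^ 2 ≠ 0 := pow_ne_zero 2 hr
  simpa [h2] using this

end Coplanar

/-! ### Frame equations, Gauss and Codazzi, and planarity of curvature lines. -/

/-- A smooth immersion `X` with unit normal `N` and conformal factor `r` in the orthogonal
directions `e`, `e'`, which are principal with opposite curvatures `L / r²` and `-L / r²`. -/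
structure PrincipalFrame (U : Set (ℝ × ℝ)) (X N : ℝ × ℝ → E3) (r L : ℝ × ℝ → ℝ)
    (e e' : ℝ × ℝ) : Prop where
  isOpen : IsOpen U
  smooth : Smooth U X
  smooth_normal : Smooth U N
  smooth_factor : Smooth U r
  pos : ∀ p ∈ U, 0 < r p
  metric : ∀ p ∈ U, ⟪dd e X p, dd e X p⟫ = r p ^ 2
  metric' : ∀ p ∈ U, ⟪dd e' X p, dd e' X p⟫ = r p ^ 2
  metric_mixed : ∀ p ∈ U, ⟪dd e X p, dd e' X p⟫ = 0
  norm_normal : ∀ p ∈ U, ‖N p‖ = 1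
  normal : ∀ p ∈ U, ⟪N p, dd e X p⟫ = 0
  normal' : ∀ p ∈ U, ⟪N p, dd e' X p⟫ = 0
  weingarten : ∀ p ∈ U, dd e N p = (-(L p / r p ^ 2)) • dd e X p
  weingarten' : ∀ p ∈ U, dd e' N p = (L p / r p ^ 2) • dd e' X p

namespace PrincipalFrame

variable {U : Set (ℝ × ℝ)} {X N : ℝ × ℝ → E3} {r L : ℝ × ℝ → ℝ} {e e' : ℝ × ℝ}

/-- Keeping the two directions abstract lets each identity be proved once: this symmetry supplies
its counterpart in the other direction, at the price of a sign of `L`. -/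
theorem swap (F : PrincipalFrame U X N r L e e') :
    PrincipalFrame U X N r (fun p => -L p) e' e where
  isOpen := F.isOpen
  smooth := F.smooth
  smooth_normal := F.smooth_normal
  smooth_factor := F.smooth_factor
  pos := F.pos
  metric := F.metric'
  metric' := F.metric
  metric_mixed p hp := by rw [real_inner_comm, F.metric_mixed p hp]
  norm_normal := F.norm_normal
  normal := F.normal'
  normal' := F.normal
  weingarten p hp := by rw [F.weingarten' p hp, neg_div, neg_neg]
  weingarten' p hp := by rw [F.weingarten p hp, neg_div]

theorem diff (F : PrincipalFrame U X N r L e e') {p : ℝ × ℝ} (hp : p ∈ U) (a : ℝ × ℝ) :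
    DifferentiableAt ℝ (dd a X) p :=
  (F.smooth.dd F.isOpen a).differentiableAt F.isOpen hp

theorem diff_normal (F : PrincipalFrame U X N r L e e') {p : ℝ × ℝ} (hp : p ∈ U) :
    DifferentiableAt ℝ N p :=
  F.smooth_normal.differentiableAt F.isOpen hp

theorem diff_factor (F : PrincipalFrame U X N r L e e') {p : ℝ × ℝ} (hp : p ∈ U) :
    DifferentiableAt ℝ r p :=
  F.smooth_factor.differentiableAt F.isOpen hp

theorem inner_metric (F : PrincipalFrame U X N r L e e') (a : ℝ × ℝ) {p : ℝ × ℝ} (hp : p ∈ U) :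
    ⟪dd a (dd e X) p, dd e X p⟫ = r p * dd a r p := by
  have h := dd_congr F.isOpen F.metric a hp
  rw [dd_inner (F.diff hp e) (F.diff hp e), dd_sq (F.diff_factor hp), real_inner_comm] at h
  linarith

theorem inner_uv_v (F : PrincipalFrame U X N r L e e') {p : ℝ × ℝ} (hp : p ∈ U) :
    ⟪dd e' (dd e X) p, dd e' X p⟫ = r p * dd e r p := by
  rw [dd_comm F.smooth F.isOpen e' e hp, F.swap.inner_metric e hp]

theorem inner_uu_v (F : PrincipalFrame U X N r L e e') {p : ℝ × ℝ} (hp : p ∈ U) :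
    ⟪dd e (dd e X) p, dd e' X p⟫ = -(r p * dd e' r p) := by
  have h := dd_eq_zero_of_const F.isOpen F.metric_mixed e hp
  rw [dd_inner (F.diff hp e) (F.diff hp e'), dd_comm F.smooth F.isOpen e e' hp,
    real_inner_comm, F.inner_metric e' hp] at h
  linarith

theorem inner_normal (F : PrincipalFrame U X N r L e e') {p : ℝ × ℝ} (hp : p ∈ U) :
    ⟪dd e (dd e X) p, N p⟫ = L p := by
  have h := dd_eq_zero_of_const F.isOpen F.normal e hp
  have hr := (F.pos p hp).ne'
  rw [dd_inner (F.diff_normal hp) (F.diff hp e), F.weingarten p hp, inner_smul_left,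
    F.metric p hp, real_inner_comm] at h
  simp at h
  field_simp at h
  linarith

theorem inner_mixed_normal (F : PrincipalFrame U X N r L e e') {p : ℝ × ℝ} (hp : p ∈ U) :
    ⟪dd e' (dd e X) p, N p⟫ = 0 := by
  have h := dd_eq_zero_of_const F.isOpen F.normal e' hp
  rw [dd_inner (F.diff_normal hp) (F.diff hp e), F.weingarten' p hp, inner_smul_left,
    real_inner_comm (dd e X p), F.metric_mixed p hp, real_inner_comm] at h
  simpa using h

theorem parseval (F : PrincipalFrame U X N r L e e') {p : ℝ × ℝ} (hp : p ∈ U) (x y : E3) :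
    r p ^ 2 * ⟪x, y⟫ = ⟪x, dd e X p⟫ * ⟪y, dd e X p⟫ + ⟪x, dd e' X p⟫ * ⟪y, dd e' X p⟫
      + r p ^ 2 * (⟪x, N p⟫ * ⟪y, N p⟫) :=
  inner_eq_of_orthogonal_frame (F.pos p hp).ne' (F.metric p hp) (F.metric' p hp)
    (F.metric_mixed p hp) (F.norm_normal p hp) (F.normal p hp) (F.normal' p hp) x y

theorem eq_zero (F : PrincipalFrame U X N r L e e') {p : ℝ × ℝ} (hp : p ∈ U) {x : E3}
    (h1 : ⟪x, dd e X p⟫ = 0) (h2 : ⟪x, dd e' X p⟫ = 0) (h3 : ⟪x, N p⟫ = 0) : x = 0 :=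
  eq_of_inner_frame (F.pos p hp).ne' (F.metric p hp) (F.metric' p hp)
    (F.metric_mixed p hp) (F.norm_normal p hp) (F.normal p hp) (F.normal' p hp) h1 h2 h3

theorem inner_self_normal (F : PrincipalFrame U X N r L e e') {p : ℝ × ℝ} (hp : p ∈ U) :
    ⟪N p, N p⟫ = 1 := by
  rw [real_inner_self_eq_norm_sq, F.norm_normal p hp, one_pow]

theorem mixed_eq (F : PrincipalFrame U X N r L e e') {p : ℝ × ℝ} (hp : p ∈ U) :
    dd e (dd e' X) p = (dd e' r p / r p) • dd e X p + (dd e r p / r p) • dd e' X p := by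
  have hr := (F.pos p hp).ne'
  have hm' : ⟪dd e' X p, dd e X p⟫ = 0 := F.swap.metric_mixed p hp
  rw [← sub_eq_zero, dd_comm F.smooth F.isOpen e e' hp]
  refine F.eq_zero hp ?_ ?_ ?_
  · rw [inner_sub_left, inner_add_left, inner_smul_left, inner_smul_left, F.inner_metric e' hp,
      F.metric p hp, hm']
    simp
    field_simp
    ring
  · rw [inner_sub_left, inner_add_left, inner_smul_left, inner_smul_left, F.inner_uv_v hp,
      F.metric' p hp, F.metric_mixed p hp]
    simp
    field_simp
    ring
  · rw [inner_sub_left, inner_add_left, inner_smul_left, inner_smul_left, F.inner_mixed_normal hp,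
      real_inner_comm, F.normal p hp, real_inner_comm, F.normal' p hp]
    simp

theorem second_eq (F : PrincipalFrame U X N r L e e') {p : ℝ × ℝ} (hp : p ∈ U) :
    dd e (dd e X) p = (dd e r p / r p) • dd e X p - (dd e' r p / r p) • dd e' X p
      + L p • N p := by
  have hr := (F.pos p hp).ne'
  have hm' : ⟪dd e' X p, dd e X p⟫ = 0 := F.swap.metric_mixed p hp
  rw [← sub_eq_zero]
  refine F.eq_zero hp ?_ ?_ ?_
  · rw [inner_sub_left, inner_add_left, inner_sub_left, inner_smul_left, inner_smul_left,
      inner_smul_left, F.inner_metric e hp, F.metric p hp, hm', F.normal p hp]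
    simp
    field_simp
    ring
  · rw [inner_sub_left, inner_add_left, inner_sub_left, inner_smul_left, inner_smul_left,
      inner_smul_left, F.inner_uu_v hp, F.metric' p hp, F.metric_mixed p hp, F.normal' p hp]
    simp
    field_simp
    ring
  · rw [inner_sub_left, inner_add_left, inner_sub_left, inner_smul_left, inner_smul_left,
      inner_smul_left, F.inner_normal hp, F.inner_self_normal hp,
      real_inner_comm, F.normal p hp, real_inner_comm, F.normal' p hp]
    simp

/-- `L` enters the structure only through the Weingarten formulas; its smoothness comes from `L =
⟨X_uu, N⟩`. -/
theorem smooth_curvature (F : PrincipalFrame U X N r L e e') : Smooth U L :=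
  (ContDiffOn.inner ℝ ((F.smooth.dd F.isOpen e).dd F.isOpen e) F.smooth_normal).congr
    fun _ hp => (F.inner_normal hp).symm

/-- The Codazzi equation. -/
theorem dd_curvature (F : PrincipalFrame U X N r L e e') {p : ℝ × ℝ} (hp : p ∈ U) :
    dd e' L p = 0 := by
  have huu := ((F.smooth.dd F.isOpen e).dd F.isOpen e).differentiableAt F.isOpen hp
  have huv := ((F.smooth.dd F.isOpen e).dd F.isOpen e').differentiableAt F.isOpen hp
  -- Differentiating `⟨X_uu, N⟩ = L` along `e'` and `⟨X_uv, N⟩ = 0` along `e` produces the same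
  -- third-order term. After subtraction the two Weingarten terms cancel because the principal
  -- curvatures are opposite.
  have h1 := dd_congr F.isOpen (fun q hq => F.inner_normal hq) e' hp
  rw [dd_inner huu (F.diff_normal hp), F.weingarten' p hp, inner_smul_right, F.inner_uu_v hp,
    dd_comm (F.smooth.dd F.isOpen e) F.isOpen e' e hp] at h1
  have h2 := dd_eq_zero_of_const F.isOpen (fun q hq => F.inner_mixed_normal hq) e hp
  rw [dd_inner huv (F.diff_normal hp), F.weingarten p hp, inner_smul_right,
    F.inner_metric e' hp] at h2
  linarith

/-- The Gauss equation. -/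
theorem gauss (F : PrincipalFrame U X N r L e e') {p : ℝ × ℝ} (hp : p ∈ U) :
    r p * (dd e (dd e r) p + dd e' (dd e' r) p)
      = L p ^ 2 + dd e r p ^ 2 + dd e' r p ^ 2 := by
  have hr := (F.pos p hp).ne'
  have huu := ((F.smooth.dd F.isOpen e).dd F.isOpen e).differentiableAt F.isOpen hp
  have huv := ((F.smooth.dd F.isOpen e).dd F.isOpen e').differentiableAt F.isOpen hp
  have hru := (F.smooth_factor.dd F.isOpen e).differentiableAt F.isOpen hp
  have hrv := (F.smooth_factor.dd F.isOpen e').differentiableAt F.isOpen hp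
  have hrr := F.diff_factor hp
  -- The third-order term `⟨X_uuv, X_v⟩` occurs both here and in `h2`. Subtraction leaves `|X_uv|² -
  -- ⟨X_uu, X_vv⟩`, which Parseval evaluates in the frame.
  have h1 := dd_congr F.isOpen (fun q hq => F.inner_uv_v hq) e hp
  rw [dd_inner huv (F.diff hp e'), dd_mul hrr hru, dd_comm F.smooth F.isOpen e e' hp] at h1
  have h2 := dd_congr F.isOpen (Z := fun q => -1 * (r q * dd e' r q))
    (fun q hq => (F.inner_uu_v hq).trans (neg_one_mul _).symm) e' hp
  rw [dd_inner huu (F.diff hp e'), dd_const_mul _ (hrr.fun_mul hrv), dd_mul hrr hrv,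
    dd_comm (F.smooth.dd F.isOpen e) F.isOpen e' e hp] at h2
  have h3 := F.parseval hp (dd e' (dd e X) p) (dd e' (dd e X) p)
  rw [F.inner_metric e' hp, F.inner_uv_v hp, F.inner_mixed_normal hp] at h3
  have h4 := F.parseval hp (dd e (dd e X) p) (dd e' (dd e' X) p)
  rw [F.inner_metric e hp, F.inner_uu_v hp, F.inner_normal hp, F.swap.inner_metric e' hp,
    F.swap.inner_uu_v hp, F.swap.inner_normal hp] at h4
  have h3' : ⟪dd e' (dd e X) p, dd e' (dd e X) p⟫ = dd e r p ^ 2 + dd e' r p ^ 2 := by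
    apply mul_left_cancel₀ (pow_ne_zero 2 hr)
    rw [h3]; ring
  have h4' : ⟪dd e (dd e X) p, dd e' (dd e' X) p⟫
      = -dd e r p ^ 2 - dd e' r p ^ 2 - L p ^ 2 := by
    apply mul_left_cancel₀ (pow_ne_zero 2 hr)
    rw [h4]; ring
  rw [h3'] at h1
  rw [h4'] at h2
  linarith

/-- The normal vector of the plane of a planar curvature line. -/
theorem dd_plane_normal (F : PrincipalFrame U X N r L e e') {l : ℝ} (hl : l ^ 2 = 1)
    (hL : ∀ p ∈ U, L p = l) {p : ℝ × ℝ} (hp : p ∈ U) (h0 : dd e (dd e' r) p = 0) :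
    dd e (fun q => (r q)⁻¹ • dd e' X q + (l * dd e' r q) • N q) p = 0 := by
  have hr := (F.pos p hp).ne'
  have hrr := F.diff_factor hp
  have hrv := (F.smooth_factor.dd F.isOpen e').differentiableAt F.isOpen hp
  have hinv : DifferentiableAt ℝ (fun q => (r q)⁻¹) p := hrr.inv hr
  have hlr : DifferentiableAt ℝ (fun q => l * dd e' r q) p := hrv.const_mul l
  rw [dd_add (hinv.fun_smul (F.diff hp e')) (hlr.fun_smul (F.diff_normal hp)),
    dd_smul hinv (F.diff hp e'), dd_smul hlr (F.diff_normal hp), dd_const_mul l hrv, h0,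
    F.weingarten p hp, F.mixed_eq hp, dd_inv hrr hr, hL p hp]
  -- The coefficient of `X_u` is `r_v / r² - l² r_v / r²`, which is where `l² = 1` enters; the
  -- coefficient of `X_v` cancels identically.
  match_scalars
  · field_simp
    linear_combination (-dd e' r p) * hl
  · field_simp
    ring
  · ring

/-- The vector `m = r⁻¹ X_v + l r_v N` is constant along the line and orthogonal to `X_u`, so `⟨m,
X⟩` is constant there. It is non-zero since `⟨m, X_v⟩ = r`. -/
theorem coplanar_of_dd_eq_zero (F : PrincipalFrame U X N r L e e') {l : ℝ} (hl : l ^ 2 = 1)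
    (hL : ∀ p ∈ U, L p = l) (h0 : ∀ p ∈ U, dd e (dd e' r) p = 0) (p : ℝ × ℝ) {I : Set ℝ}
    (hI : I.OrdConnected) (hIU : ∀ t ∈ I, p + t • e ∈ U) :
    Coplanar ℝ ((fun t => X (p + t • e)) '' I) := by
  rcases I.eq_empty_or_nonempty with rfl | ⟨t₀, ht₀⟩
  · simp [coplanar_empty]
  set m : ℝ × ℝ → E3 := fun q => (r q)⁻¹ • dd e' X q + (l * dd e' r q) • N q with hm
  have hdm : ∀ q ∈ U, DifferentiableAt ℝ m q := fun q hq =>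
    (((F.diff_factor hq).inv (F.pos q hq).ne').smul (F.diff hq e')).add
      ((((F.smooth_factor.dd F.isOpen e').differentiableAt F.isOpen hq).const_mul l).smul
        (F.diff_normal hq))
  have hconst : ∀ t ∈ I, m (p + t • e) = m (p + t₀ • e) := fun t ht =>
    eq_of_dd_eq_zero_on_line hI (fun s hs => hdm _ (hIU s hs))
      (fun s hs => F.dd_plane_normal hl hL (hIU s hs) (h0 _ (hIU s hs))) ht ht₀
  have hmu : ∀ q ∈ U, ⟪m q, dd e X q⟫ = 0 := by
    intro q hq
    simp only [hm]
    rw [inner_add_left, inner_smul_left, inner_smul_left, F.normal q hq,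
      F.swap.metric_mixed q hq]
    simp
  set n := m (p + t₀ • e) with hn
  have hXd : ∀ t ∈ I, DifferentiableAt ℝ X (p + t • e) := fun t ht =>
    F.smooth.differentiableAt F.isOpen (hIU t ht)
  refine coplanar_of_inner_eq (n := n) ?_ ?_
  · intro hz
    have hU0 := hIU t₀ ht₀
    have h1 : ⟪m (p + t₀ • e), dd e' X (p + t₀ • e)⟫ = r (p + t₀ • e) := by
      have hr := (F.pos _ hU0).ne'
      simp only [hm]
      rw [inner_add_left, inner_smul_left, inner_smul_left, F.normal' _ hU0, F.metric' _ hU0]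
      simp
      field_simp
    rw [← hn, hz, inner_zero_left] at h1
    exact (F.pos _ hU0).ne h1
  · rintro _ ⟨s, hs, rfl⟩ _ ⟨t, ht, rfl⟩
    have key := eq_of_dd_eq_zero_on_line (Y := fun q => ⟪n, X q⟫) (e := e) (p := p) hI
      (fun s hs => (differentiableAt_const n).inner ℝ (hXd s hs))
      (fun s hs => by
        rw [dd_inner (differentiableAt_const n) (hXd s hs), dd_const, inner_zero_left, add_zero,
          ← hconst s hs, hmu _ (hIU s hs)]) hs ht
    simp only at key ⊢
    rw [inner_sub_right, key, sub_self]

/-- If a curvature line lies in a plane near a point, the mixed derivative of the conformal factor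
vanishes there. -/
theorem dd_eq_zero_of_coplanar (F : PrincipalFrame U X N r L e e') {l : ℝ} (hl : l ^ 2 = 1)
    (hL : ∀ p ∈ U, L p = l)
    (h : ∀ (p : ℝ × ℝ) (I : Set ℝ), I.OrdConnected → (∀ t ∈ I, p + t • e ∈ U) →
      Coplanar ℝ ((fun t => X (p + t • e)) '' I)) {p : ℝ × ℝ} (hp : p ∈ U) :
    dd e (dd e' r) p = 0 := by
  have hl0 : l ≠ 0 := by
    rintro rfl
    norm_num at hl
  have hcont : Continuous fun t : ℝ => p + t • e := by fun_prop
  -- An open segment around `p` suffices, and openness allows differentiation at each of its points.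
  obtain ⟨ε, hε, hball⟩ := Metric.isOpen_iff.mp (F.isOpen.preimage hcont) 0 (by simpa using hp)
  set I := Metric.ball (0 : ℝ) ε with hIdef
  have hIU : ∀ t ∈ I, p + t • e ∈ U := fun t ht => hball ht
  have hIo : I.OrdConnected := (convex_ball (0 : ℝ) ε).ordConnected
  obtain ⟨n, hn, hin⟩ := (h p I hIo hIU).exists_inner_eq_zero
  have h0I : (0 : ℝ) ∈ I := Metric.mem_ball_self hε
  have hInhds : ∀ t ∈ I, I ∈ nhds t := fun t ht => Metric.isOpen_ball.mem_nhds ht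
  -- differentiation along the line
  have hder : ∀ (Z : ℝ × ℝ → E3), Smooth U Z → (∃ c, ∀ t ∈ I, ⟪n, Z (p + t • e)⟫ = c) →
      ∀ t ∈ I, ⟪n, dd e Z (p + t • e)⟫ = 0 := by
    rintro Z hZ ⟨c, hc⟩ t ht
    have hline : HasDerivAt (fun x : ℝ => p + x • e) e t := by
      simpa using ((hasDerivAt_id t).smul_const e).const_add p
    have h1 := (hZ.differentiableAt F.isOpen (hIU t ht)).hasFDerivAt.comp_hasDerivAt t hline
    have h2 := (hasDerivAt_const t n).inner ℝ h1
    have h3 : HasDerivAt (fun x : ℝ => ⟪n, Z (p + x • e)⟫) 0 t :=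
      (hasDerivAt_const t c).congr_of_eventuallyEq
        (Filter.eventually_of_mem (hInhds t ht) hc)
    have h4 := h2.unique h3
    rw [inner_zero_left, add_zero] at h4
    exact h4
  have hu : ∀ t ∈ I, ⟪n, dd e X (p + t • e)⟫ = 0 :=
    hder X F.smooth ⟨⟪n, X (p + (0 : ℝ) • e)⟫, fun t ht => by
      have := hin _ ⟨t, ht, rfl⟩ _ ⟨0, h0I, rfl⟩
      rw [inner_sub_right] at this
      linarith⟩
  -- This is `⟨n, X_uu⟩ = 0`, with the `X_u` component dropped and the rest multiplied by `r`.
  have hw : ∀ t ∈ I, ⟪n, (-dd e' r (p + t • e)) • dd e' X (p + t • e)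
      + (r (p + t • e) * l) • N (p + t • e)⟫ = 0 := by
    intro t ht
    have hq := hIU t ht
    have hr := (F.pos _ hq).ne'
    have h1 := hder (dd e X) (F.smooth.dd F.isOpen e) ⟨0, hu⟩ t ht
    rw [F.second_eq hq, inner_add_right, inner_sub_right, inner_smul_right, inner_smul_right,
      inner_smul_right, hu t ht, hL _ hq] at h1
    rw [inner_add_right, inner_smul_right, inner_smul_right]
    field_simp at h1
    linarith
  have hsm : Smooth U fun q => (-dd e' r q) • dd e' X q + (r q * l) • N q :=
    ((F.smooth_factor.dd F.isOpen e').neg.smul (F.smooth.dd F.isOpen e')).add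
      ((F.smooth_factor.mul contDiffOn_const).smul F.smooth_normal)
  have h2 := hder _ hsm ⟨0, hw⟩ 0 h0I
  have h1 := hw 0 h0I
  have h3 := hu 0 h0I
  rw [zero_smul, add_zero] at h1 h2 h3
  have hr := (F.pos p hp).ne'
  have hrr := F.diff_factor hp
  have hrv := (F.smooth_factor.dd F.isOpen e').differentiableAt F.isOpen hp
  have hnrv : DifferentiableAt ℝ (fun q => -1 * dd e' r q) p := hrv.const_mul (-1)
  have hrl : DifferentiableAt ℝ (fun q => l * r q) p := hrr.const_mul l
  have heq : (fun q => (-dd e' r q) • dd e' X q + (r q * l) • N q)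
      = fun q => (-1 * dd e' r q) • dd e' X q + (l * r q) • N q := by
    funext q
    rw [neg_one_mul, mul_comm l]
  rw [heq, dd_add (hnrv.fun_smul (F.diff hp e')) (hrl.fun_smul (F.diff_normal hp)),
    dd_smul hnrv (F.diff hp e'), dd_smul hrl (F.diff_normal hp), dd_const_mul _ hrv,
    dd_const_mul _ hrr, F.weingarten p hp, F.mixed_eq hp] at h2
  simp only [inner_add_right, inner_smul_right, h3] at h1 h2
  -- Modulo `X_u`, which is orthogonal to `n`, one has `X_uv ≡ (r_u / r) X_v` and `N_u ≡ 0`. The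
  -- derivative of the relation `hw` is therefore `r_u / r` times that relation, minus `r_uv ⟨n,
  -- X_v⟩`.
  have h4 : dd e (dd e' r) p * ⟪n, dd e' X p⟫ = 0 := by
    have h5 : r p * (dd e (dd e' r) p * ⟪n, dd e' X p⟫) = 0 := by
      field_simp at h2
      linear_combination (-1 : ℝ) * h2 + dd e r p * h1
    exact (mul_eq_zero.mp h5).resolve_left hr
  -- If `⟨n, X_v⟩ = 0`, then `h1` forces `⟨n, N⟩ = 0`, so `n` is orthogonal to the whole frame.
  refine (mul_eq_zero.mp h4).resolve_right fun hnv => hn ?_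
  refine F.eq_zero hp h3 hnv ?_
  rw [hnv, mul_zero, zero_add] at h1
  exact (mul_eq_zero.mp h1).resolve_left (mul_ne_zero hr hl0)

/-- With `L = 0` the Weingarten formulas make `N` constant, and `⟨N, X⟩` then has zero gradient. -/
theorem coplanar_of_curvature_eq_zero (F : PrincipalFrame U X N r L (1, 0) (0, 1))
    (hc : IsPreconnected U) (hL : ∀ p ∈ U, L p = 0) : Coplanar ℝ (X '' U) := by
  rcases U.eq_empty_or_nonempty with rfl | ⟨p₀, hp₀⟩
  · simp [coplanar_empty]
  have hN : ∀ p ∈ U, N p = N p₀ := fun p hp =>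
    eq_of_partials_eq_zero F.isOpen hc F.smooth_normal
      (fun q hq => by rw [F.weingarten q hq, hL q hq]; simp)
      (fun q hq => by rw [F.weingarten' q hq, hL q hq]; simp) hp hp₀
  refine coplanar_of_inner_eq (n := N p₀) ?_ ?_
  · intro h
    have := F.norm_normal p₀ hp₀
    rw [h, norm_zero] at this
    exact zero_ne_one this
  · rintro _ ⟨p, hp, rfl⟩ _ ⟨q, hq, rfl⟩
    have hd : ∀ x ∈ U, DifferentiableAt ℝ X x := fun x hx => F.smooth.differentiableAt F.isOpen hx
    have key := eq_of_partials_eq_zero (Y := fun x => ⟪N p₀, X x⟫) F.isOpen hc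
      (ContDiffOn.inner ℝ contDiffOn_const F.smooth)
      (fun x hx => by
        rw [dd_inner (differentiableAt_const _) (hd x hx), dd_const, inner_zero_left, ← hN x hx,
          F.normal x hx, add_zero])
      (fun x hx => by
        rw [dd_inner (differentiableAt_const _) (hd x hx), dd_const, inner_zero_left, ← hN x hx,
          F.normal' x hx, add_zero]) hp hq
    rw [inner_sub_right, key, sub_self]

/-- The Codazzi equation handles one direction for the frame and the other for the swapped frame. -/
theorem curvature_const (F : PrincipalFrame U X N r L (1, 0) (0, 1)) (hc : IsPreconnected U)
    {p q : ℝ × ℝ} (hp : p ∈ U) (hq : q ∈ U) : L p = L q :=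
  eq_of_partials_eq_zero F.isOpen hc F.smooth_curvature
    (fun x hx => by
      have h : dd (1, 0) (fun y => -L y) x = 0 := F.swap.dd_curvature hx
      have hd := F.smooth_curvature.differentiableAt F.isOpen hx
      rw [show (fun y => -L y) = fun y => -1 * L y from funext fun y => (neg_one_mul _).symm,
        dd_const_mul _ hd] at h
      linarith)
    (fun _ hx => F.dd_curvature hx) hp hq

end PrincipalFrame

/-! ### Solutions of `y'' = c y`, uniformly in the sign of `c`. -/

section GeneralizedSinh

/-- The solution of `y'' = c y` with `y 0 = 0` and `y' 0 = 1`. -/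
noncomputable def gsinh (c x : ℝ) : ℝ :=
  if 0 < c then Real.sinh (√c * x) / √c
  else if c < 0 then Real.sin (√(-c) * x) / √(-c) else x

/-- The solution of `y'' = c y` with `y 0 = 1` and `y' 0 = 0`. -/
noncomputable def gcosh (c x : ℝ) : ℝ :=
  if 0 < c then Real.cosh (√c * x) else if c < 0 then Real.cos (√(-c) * x) else 1

theorem gsinh_of_pos {c : ℝ} (h : 0 < c) (x : ℝ) : gsinh c x = Real.sinh (√c * x) / √c := by
  simp [gsinh, h]

theorem gcosh_of_pos {c : ℝ} (h : 0 < c) (x : ℝ) : gcosh c x = Real.cosh (√c * x) := by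
  simp [gcosh, h]

theorem gsinh_of_neg {c : ℝ} (h : c < 0) (x : ℝ) :
    gsinh c x = Real.sin (√(-c) * x) / √(-c) := by
  simp [gsinh, h, not_lt.mpr h.le]

theorem gcosh_of_neg {c : ℝ} (h : c < 0) (x : ℝ) : gcosh c x = Real.cos (√(-c) * x) := by
  simp [gcosh, h, not_lt.mpr h.le]

theorem gsinh_zero_left (x : ℝ) : gsinh 0 x = x := by simp [gsinh]

theorem gcosh_zero_left (x : ℝ) : gcosh 0 x = 1 := by simp [gcosh]

theorem gsinh_zero_right (c : ℝ) : gsinh c 0 = 0 := by simp [gsinh]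

theorem sqrt_pos_and_sq {c : ℝ} (h : 0 < c) : 0 < √c ∧ √c ^ 2 = c :=
  ⟨Real.sqrt_pos.mpr h, Real.sq_sqrt h.le⟩

theorem hasDerivAt_const_mul_id (k x : ℝ) : HasDerivAt (fun x : ℝ => k * x) k x := by
  simpa using (hasDerivAt_id x).const_mul k

theorem hasDerivAt_gsinh (c x : ℝ) : HasDerivAt (gsinh c) (gcosh c x) x := by
  rcases lt_trichotomy c 0 with h | h | h
  · have hs := (sqrt_pos_and_sq (neg_pos.mpr h)).1
    rw [funext (gsinh_of_neg h), gcosh_of_neg h]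
    exact ((hasDerivAt_const_mul_id (√(-c)) x).sin.div_const (√(-c))).congr_deriv (by field_simp)
  · subst h
    rw [funext gsinh_zero_left, gcosh_zero_left]
    exact hasDerivAt_id x
  · have hs := (sqrt_pos_and_sq h).1
    rw [funext (gsinh_of_pos h), gcosh_of_pos h]
    exact ((hasDerivAt_const_mul_id (√c) x).sinh.div_const (√c)).congr_deriv (by field_simp)

theorem hasDerivAt_gcosh (c x : ℝ) : HasDerivAt (gcosh c) (c * gsinh c x) x := by
  rcases lt_trichotomy c 0 with h | h | h
  · obtain ⟨hs, hq⟩ := sqrt_pos_and_sq (neg_pos.mpr h)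
    rw [funext (gcosh_of_neg h), gsinh_of_neg h]
    refine (hasDerivAt_const_mul_id (√(-c)) x).cos.congr_deriv ?_
    field_simp
    linear_combination (-Real.sin (√(-c) * x)) * hq
  · subst h
    rw [funext gcosh_zero_left]
    simpa using hasDerivAt_const x (1 : ℝ)
  · obtain ⟨hs, hq⟩ := sqrt_pos_and_sq h
    rw [funext (gcosh_of_pos h), gsinh_of_pos h]
    refine (hasDerivAt_const_mul_id (√c) x).cosh.congr_deriv ?_
    field_simp
    linear_combination Real.sinh (√c * x) * hq

theorem analyticAt_gsinh (c x : ℝ) : AnalyticAt ℝ (gsinh c) x := by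
  have hl : ∀ k : ℝ, AnalyticAt ℝ (fun x : ℝ => k * x) x := fun k =>
    analyticAt_const.mul analyticAt_id
  rcases lt_trichotomy c 0 with h | h | h
  · rw [funext (gsinh_of_neg h)]
    exact (Real.analyticAt_sin.comp (hl _)).div_const
  · subst h
    rw [funext gsinh_zero_left]
    exact analyticAt_id
  · rw [funext (gsinh_of_pos h)]
    exact (Real.analyticAt_sinh.comp (hl _)).div_const

theorem analyticAt_gcosh (c x : ℝ) : AnalyticAt ℝ (gcosh c) x := by
  have hl : ∀ k : ℝ, AnalyticAt ℝ (fun x : ℝ => k * x) x := fun k =>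
    analyticAt_const.mul analyticAt_id
  rcases lt_trichotomy c 0 with h | h | h
  · rw [funext (gcosh_of_neg h)]
    exact Real.analyticAt_cos.comp (hl _)
  · subst h
    rw [funext gcosh_zero_left]
    exact analyticAt_const
  · rw [funext (gcosh_of_pos h)]
    exact Real.analyticAt_cosh.comp (hl _)

theorem gcosh_sq (c x : ℝ) : gcosh c x ^ 2 = 1 + c * gsinh c x ^ 2 := by
  rcases lt_trichotomy c 0 with h | h | h
  · obtain ⟨hs, hq⟩ := sqrt_pos_and_sq (neg_pos.mpr h)
    rw [gcosh_of_neg h, gsinh_of_neg h, div_pow, hq, Real.cos_sq']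
    have := h.ne
    field_simp
    ring
  · subst h
    simp [gcosh_zero_left]
  · obtain ⟨hs, hq⟩ := sqrt_pos_and_sq h
    rw [gcosh_of_pos h, gsinh_of_pos h, div_pow, hq, Real.cosh_sq]
    field_simp
    ring

theorem gsinh_sub (c x y : ℝ) :
    gsinh c (x - y) = gsinh c x * gcosh c y - gcosh c x * gsinh c y := by
  rcases lt_trichotomy c 0 with h | h | h
  · simp only [gcosh_of_neg h, gsinh_of_neg h, mul_sub, Real.sin_sub]
    ring
  · subst h
    simp [gcosh_zero_left, gsinh_zero_left]
  · simp only [gcosh_of_pos h, gsinh_of_pos h, mul_sub, Real.sinh_sub]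
    ring

theorem gcosh_sub (c x y : ℝ) :
    gcosh c (x - y) = gcosh c x * gcosh c y - c * gsinh c x * gsinh c y := by
  rcases lt_trichotomy c 0 with h | h | h
  · obtain ⟨hs, hq⟩ := sqrt_pos_and_sq (neg_pos.mpr h)
    simp only [gcosh_of_neg h, gsinh_of_neg h, mul_sub, Real.cos_sub]
    field_simp
    rw [hq]
    ring
  · subst h
    simp [gcosh_zero_left]
  · obtain ⟨hs, hq⟩ := sqrt_pos_and_sq h
    simp only [gcosh_of_pos h, gsinh_of_pos h, mul_sub, Real.cosh_sub]
    field_simp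
    rw [hq]
    ring

theorem one_le_gcosh {c : ℝ} (h : 0 ≤ c) (x : ℝ) : 1 ≤ gcosh c x := by
  rcases h.eq_or_lt with rfl | h
  · rw [gcosh_zero_left]
  · rw [gcosh_of_pos h]
    exact Real.one_le_cosh _

theorem abs_gcosh_le_one {c : ℝ} (h : c ≤ 0) (x : ℝ) : |gcosh c x| ≤ 1 := by
  rw [← sq_le_one_iff_abs_le_one, gcosh_sq]
  nlinarith [sq_nonneg (gsinh c x)]

theorem gsinh_eq_zero {c : ℝ} (h : 0 ≤ c) {x : ℝ} (hx : gsinh c x = 0) : x = 0 := by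
  rcases h.eq_or_lt with rfl | h
  · rwa [gsinh_zero_left] at hx
  · rw [gsinh_of_pos h] at hx
    have hs := (sqrt_pos_and_sq h).1
    simpa [hs.ne'] using hx

theorem exists_gsinh_ne_zero (c : ℝ) : ∃ x, gsinh c x ≠ 0 := by
  rcases lt_or_ge c 0 with h | h
  · have hs := (sqrt_pos_and_sq (neg_pos.mpr h)).1
    refine ⟨Real.pi / 2 / √(-c), ?_⟩
    rw [gsinh_of_neg h, mul_div_cancel₀ _ hs.ne']
    simp [hs.ne']
  · exact ⟨1, fun h1 => one_ne_zero (gsinh_eq_zero h h1)⟩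

theorem exists_period_of_neg {c : ℝ} (h : c < 0) :
    ∃ T : ℝ, 0 < T ∧ Function.Periodic (gsinh c) T ∧ Function.Periodic (gcosh c) T := by
  have hs := (sqrt_pos_and_sq (neg_pos.mpr h)).1
  refine ⟨2 * Real.pi / √(-c), by positivity, fun x => ?_, fun x => ?_⟩
  · rw [gsinh_of_neg h, gsinh_of_neg h, mul_add, mul_div_cancel₀ _ hs.ne', Real.sin_add_two_pi]
  · rw [gcosh_of_neg h, gcosh_of_neg h, mul_add, mul_div_cancel₀ _ hs.ne', Real.cos_add_two_pi]

/-- A solution `a * gcosh c x + b * gsinh c x` of `y'' = c y` which has a zero is a multiple of a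
shift of `gsinh c`. -/
theorem exists_shift {c a b : ℝ} (h0 : 0 ≤ b ^ 2 - c * a ^ 2)
    (h : c < 0 ∨ 0 < b ^ 2 - c * a ^ 2) :
    ∃ α x₀ : ℝ, α ^ 2 = b ^ 2 - c * a ^ 2 ∧ a = -α * gsinh c x₀ ∧ b = α * gcosh c x₀ := by
  rcases lt_trichotomy c 0 with hc | hc | hc
  · obtain ⟨hs, hq⟩ := sqrt_pos_and_sq (neg_pos.mpr hc)
    -- Polar coordinates of this number give amplitude and phase of the oscillation; its squared
    -- norm is the first integral.
    let z : ℂ := ⟨b, -(√(-c) * a)⟩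
    have hz : ‖z‖ ^ 2 = b ^ 2 - c * a ^ 2 := by
      rw [← Complex.normSq_eq_norm_sq, Complex.normSq_mk]
      linear_combination a ^ 2 * hq
    have hre : ‖z‖ * Real.cos z.arg = b := Complex.norm_mul_cos_arg z
    have him : ‖z‖ * Real.sin z.arg = -(√(-c) * a) := Complex.norm_mul_sin_arg z
    refine ⟨‖z‖, z.arg / √(-c), hz, ?_, ?_⟩
    · rw [gsinh_of_neg hc, mul_div_cancel₀ _ hs.ne']
      field_simp
      linarith
    · rw [gcosh_of_neg hc, mul_div_cancel₀ _ hs.ne', hre]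
  · subst hc
    have hb : b ≠ 0 := by
      rintro rfl
      simp at h
    refine ⟨b, -a / b, by ring, ?_, ?_⟩
    · rw [gsinh_zero_left]; field_simp
    · rw [gcosh_zero_left, mul_one]
  · obtain ⟨hs, hq⟩ := sqrt_pos_and_sq hc
    have hd : 0 < b ^ 2 - c * a ^ 2 := h.resolve_left hc.not_gt
    obtain ⟨hr, hrq⟩ := sqrt_pos_and_sq hd
    -- Since `cosh > 0`, the amplitude must carry the sign of `b`; both signs are treated at once
    -- through `0 < b / α`.
    have key : ∀ α : ℝ, α ^ 2 = b ^ 2 - c * a ^ 2 → 0 < b / α → 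
        ∃ x₀ : ℝ, a = -α * gsinh c x₀ ∧ b = α * gcosh c x₀ := by
      intro α hα hpos
      have hα0 : α ≠ 0 := by
        rintro rfl
        simp at hpos
      refine ⟨Real.arsinh (-(√c * a) / α) / √c, ?_, ?_⟩
      · rw [gsinh_of_pos hc, mul_div_cancel₀ _ hs.ne', Real.sinh_arsinh]
        field_simp
      · rw [gcosh_of_pos hc, mul_div_cancel₀ _ hs.ne', Real.cosh_arsinh]
        have : 1 + (-(√c * a) / α) ^ 2 = (b / α) ^ 2 := by
          field_simp
          linear_combination hα + a ^ 2 * hq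
        rw [this, Real.sqrt_sq hpos.le, mul_div_cancel₀ _ hα0]
    rcases lt_trichotomy b 0 with hb | hb | hb
    · obtain ⟨x₀, h1, h2⟩ := key (-√(b ^ 2 - c * a ^ 2)) (by rw [neg_sq, hrq])
        (div_pos_of_neg_of_neg hb (by linarith))
      exact ⟨_, x₀, by rw [neg_sq, hrq], h1, h2⟩
    · subst hb
      nlinarith [sq_nonneg a]
    · obtain ⟨x₀, h1, h2⟩ := key (√(b ^ 2 - c * a ^ 2)) hrq (div_pos hb hr)
      exact ⟨_, x₀, hrq, h1, h2⟩

end GeneralizedSinh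

/-! ### The explicit metric functions: positivity, derivatives, periodicity. -/

section Metric

/-- Removes the case distinction: with `c = α² - β²`, `f` solves `y'' = c y` and `g` solves `y'' =
-c y`. -/
theorem profile_eq (α β x : ℝ) : profile α β x = α * gsinh (α ^ 2 - β ^ 2) x := by
  unfold profile gsinh
  simp only [sub_pos, sub_neg, neg_sub]
  split_ifs <;> ring

theorem hasDerivAt_profile (α β x : ℝ) :
    HasDerivAt (profile α β) (α * gcosh (α ^ 2 - β ^ 2) x) x := by
  rw [funext (profile_eq α β)]
  exact (hasDerivAt_gsinh _ x).const_mul α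

theorem metricDen_eq (α β u v : ℝ) :
    metricDen α β u v = α * gcosh (α ^ 2 - β ^ 2) u + β * gcosh (β ^ 2 - α ^ 2) v := by
  rw [metricDen, (hasDerivAt_profile α β u).deriv, (hasDerivAt_profile β α v).deriv]

theorem metricDen_comm (α β u v : ℝ) : metricDen α β u v = metricDen β α v u := by
  rw [metricDen, metricDen, add_comm]

theorem metricFn_comm (α β u v : ℝ) : metricFn α β u v = metricFn β α v u := by
  rw [metricFn, metricFn, metricDen_comm, add_right_comm]

/-- When `β² < α²`, the hyperbolic term is at least `α`, while the trigonometric one is at most `|β|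
< α` in absolute value. When `α² = β²` the denominator is the constant `α + β`. -/
theorem metricDen_pos {α β : ℝ} (h : 0 < α + β) (u v : ℝ) : 0 < metricDen α β u v := by
  have key : ∀ {α β : ℝ} (u v : ℝ), 0 < α + β → β ^ 2 ≤ α ^ 2 → 0 < metricDen α β u v := by
    intro α β u v h hle
    rw [metricDen_eq]
    rcases hle.eq_or_lt with heq | hlt
    · rw [heq, sub_self, gcosh_zero_left, gcosh_zero_left]
      linarith
    · have h1 := one_le_gcosh (sub_pos.mpr hlt).le u
      have h2 := abs_gcosh_le_one (sub_neg.mpr hlt).le v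
      have h3 : |β * gcosh (β ^ 2 - α ^ 2) v| ≤ |β| := by
        rw [abs_mul]
        exact mul_le_of_le_one_right (abs_nonneg _) h2
      have hα : 0 < α := by nlinarith
      have h4 : |β| < α := by
        have := sq_lt_sq.mp hlt
        rwa [abs_of_pos hα] at this
      have h5 := neg_abs_le (β * gcosh (β ^ 2 - α ^ 2) v)
      nlinarith
  rcases le_total (β ^ 2) (α ^ 2) with hle | hle
  · exact key u v h hle
  · rw [metricDen_comm]
    exact key v u (by linarith) hle

/-- The denominator is odd under `(α, β) ↦ (-α, -β)` and vanishes identically for `β = -α`. -/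
theorem pos_of_metricDen_pos {α β u v : ℝ} (h : 0 < metricDen α β u v) : 0 < α + β := by
  by_contra! hle
  rcases hle.eq_or_lt with h0 | hlt
  · have hβ : β = -α := by linarith
    subst hβ
    rw [metricDen_eq, neg_sq, sub_self, gcosh_zero_left, gcosh_zero_left] at h
    linarith
  · have := metricDen_pos (α := -α) (β := -β) (by linarith) u v
    rw [metricDen_eq, neg_sq, neg_sq] at this
    rw [metricDen_eq] at h
    linarith

theorem metricFn_pos {α β : ℝ} (h : 0 < α + β) (u v : ℝ) : 0 < metricFn α β u v :=
  div_pos (by positivity) (metricDen_pos h u v)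

/-- After the quotient rule the claim amounts to `f'² - g'² = (α² - β²)(1 + f² + g²)`, which follows
from the first integrals `f'² = α² + c f²` and `g'² = β² - c g²` with `c = α² - β²`. -/
theorem hasDerivAt_metricFn_left {α β : ℝ} (h : 0 < α + β) (u v : ℝ) :
    HasDerivAt (fun u => metricFn α β u v) (profile α β u) u := by
  have hden := metricDen_pos h u v
  have hnum : HasDerivAt (fun u => 1 + profile α β u ^ 2 + profile β α v ^ 2)
      (2 * profile α β u * (α * gcosh (α ^ 2 - β ^ 2) u)) u := by
    simpa using (((hasDerivAt_profile α β u).pow 2).const_add 1).add_const (profile β α v ^ 2)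
  have hd : HasDerivAt (fun u => metricDen α β u v)
      (α * ((α ^ 2 - β ^ 2) * gsinh (α ^ 2 - β ^ 2) u)) u := by
    simp only [metricDen_eq]
    exact ((hasDerivAt_gcosh _ u).const_mul α).add_const _
  refine (hnum.div hd hden.ne').congr_deriv ?_
  rw [div_eq_iff (pow_ne_zero 2 hden.ne')]
  have h1 := gcosh_sq (α ^ 2 - β ^ 2) u
  have h2 := gcosh_sq (β ^ 2 - α ^ 2) v
  simp only [metricDen_eq, profile_eq]
  linear_combination (α * gsinh (α ^ 2 - β ^ 2) u * α ^ 2) * h1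
    - (α * gsinh (α ^ 2 - β ^ 2) u * β ^ 2) * h2

theorem hasDerivAt_metricFn_right {α β : ℝ} (h : 0 < α + β) (u v : ℝ) :
    HasDerivAt (fun v => metricFn α β u v) (profile β α v) v := by
  simp only [metricFn_comm α β u]
  exact hasDerivAt_metricFn_left (by linarith) v u

theorem analyticOnNhd_log_metricFn {α β : ℝ} (h : 0 < α + β) (u₀ v₀ : ℝ) :
    AnalyticOnNhd ℝ (fun p : ℝ × ℝ => Real.log (metricFn α β (p.1 - u₀) (p.2 - v₀)))
      Set.univ := by
  intro p _
  have hu : AnalyticAt ℝ (fun p : ℝ × ℝ => p.1 - u₀) p := analyticAt_fst.sub analyticAt_const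
  have hv : AnalyticAt ℝ (fun p : ℝ × ℝ => p.2 - v₀) p := analyticAt_snd.sub analyticAt_const
  refine AnalyticAt.fun_comp (analyticAt_log (metricFn_pos h _ _)) ?_
  refine AnalyticAt.div ?_ ?_ (metricDen_pos h _ _).ne'
  · simp only [profile_eq]
    exact (analyticAt_const.add ((analyticAt_const.mul
      ((analyticAt_gsinh _ _).comp hu)).pow 2)).add
      ((analyticAt_const.mul ((analyticAt_gsinh _ _).comp hv)).pow 2)
  · simp only [metricDen_eq]
    exact (analyticAt_const.mul ((analyticAt_gcosh _ _).comp hu)).add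
      (analyticAt_const.mul ((analyticAt_gcosh _ _).comp hv))

/-- A period of the function is a period of its derivative `f`. Since `f` vanishes at `0`, it
vanishes at `T`, but for `β² ≤ α²` its only zero is `0`. -/
theorem eq_zero_of_periodic_metricFn {α β : ℝ} (h : 0 < α + β) (hα : α ≠ 0)
    (hle : β ^ 2 ≤ α ^ 2) {v T : ℝ} (hT : Function.Periodic (fun u => metricFn α β u v) T) :
    T = 0 := by
  have h1 : HasDerivAt (fun u => metricFn α β u v) (profile α β T) 0 := by
    have := (hasDerivAt_metricFn_left h (0 + T) v).comp_add_const 0 T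
    rw [zero_add] at this
    rwa [show (fun u => metricFn α β (u + T) v) = fun u => metricFn α β u v from funext hT] at this
  have h2 := h1.unique (hasDerivAt_metricFn_left h 0 v)
  rw [profile_eq, profile_eq, gsinh_zero_right, mul_zero] at h2
  exact gsinh_eq_zero (sub_nonneg.mpr hle) ((mul_eq_zero.mp h2).resolve_left hα)

theorem exists_period_metricFn {α β : ℝ} (hlt : α ^ 2 < β ^ 2) :
    ∃ T : ℝ, 0 < T ∧ ∀ v, Function.Periodic (fun u => metricFn α β u v) T := by
  obtain ⟨T, hT, h1, h2⟩ := exists_period_of_neg (sub_neg.mpr hlt)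
  refine ⟨T, hT, fun v u => ?_⟩
  simp only [metricFn, metricDen_eq, profile_eq, h1 u, h2 u]

theorem exists_metricFn_ne {α β : ℝ} (h : 0 < α + β) (hα : α ≠ 0) (v : ℝ) :
    ∃ u u', metricFn α β u v ≠ metricFn α β u' v := by
  by_contra! hc
  obtain ⟨x, hx⟩ := exists_gsinh_ne_zero (α ^ 2 - β ^ 2)
  have h1 := hasDerivAt_metricFn_left h x v
  rw [show (fun u => metricFn α β u v) = fun _ => metricFn α β 0 v from
    funext fun u => hc u 0] at h1
  have h2 := h1.unique (hasDerivAt_const x _)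
  rw [profile_eq] at h2
  exact (mul_ne_zero hα hx) h2

theorem metricFn_zero_left (β u u' v : ℝ) : metricFn 0 β u v = metricFn 0 β u' v := by
  simp [metricFn, metricDen_eq, profile_eq]

/-- The logarithm of the shifted metric function on the whole plane. -/
noncomputable def logMetric (α β u₀ v₀ : ℝ) (p : ℝ × ℝ) : ℝ :=
  Real.log (metricFn α β (p.1 - u₀) (p.2 - v₀))

theorem exp_logMetric {α β : ℝ} (h : 0 < α + β) (u₀ v₀ u v : ℝ) :
    Real.exp (logMetric α β u₀ v₀ (u, v)) = metricFn α β (u - u₀) (v - v₀) :=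
  Real.exp_log (metricFn_pos h _ _)

theorem logMetric_swap (α β u₀ v₀ u v : ℝ) :
    logMetric α β u₀ v₀ (u, v) = logMetric β α v₀ u₀ (v, u) := by
  simp only [logMetric]
  rw [metricFn_comm]

theorem notPeriodicU_logMetric {α β : ℝ} (h : 0 < α + β) (hα : α ≠ 0) (hle : β ^ 2 ≤ α ^ 2)
    (u₀ v₀ : ℝ) : NotPeriodicU (logMetric α β u₀ v₀) := by
  intro v T hT hper
  refine hT (eq_zero_of_periodic_metricFn h hα hle (v := v - v₀) (T := T) fun u => ?_)
  have h1 := congrArg Real.exp (hper (u + u₀))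
  simp only [exp_logMetric h] at h1
  rwa [show u + u₀ + T - u₀ = u + T by ring, add_sub_cancel_right] at h1

theorem properlyPeriodicU_logMetric {α β : ℝ} (h : 0 < α + β) (hα : α ≠ 0) (hlt : α ^ 2 < β ^ 2)
    (u₀ v₀ : ℝ) : ProperlyPeriodicU (logMetric α β u₀ v₀) := by
  constructor
  · obtain ⟨T, hT, hper⟩ := exists_period_metricFn hlt
    refine ⟨T, hT, fun v u => ?_⟩
    have := hper (v - v₀) (u - u₀)
    simp only [logMetric]
    rw [show u + T - u₀ = u - u₀ + T by ring]
    exact congrArg Real.log this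
  · intro v
    obtain ⟨u, u', hne⟩ := exists_metricFn_ne h hα (v - v₀)
    refine ⟨u + u₀, u' + u₀, fun heq => hne ?_⟩
    have := congrArg Real.exp heq
    simpa only [exp_logMetric h, add_sub_cancel_right] using this

theorem constantU_logMetric (β u₀ v₀ : ℝ) : ConstantU (logMetric 0 β u₀ v₀) := by
  intro u u' v
  simp only [logMetric]
  rw [metricFn_zero_left]

theorem notPeriodicV_logMetric {α β : ℝ} (h : 0 < α + β) (hβ : β ≠ 0) (hle : α ^ 2 ≤ β ^ 2)
    (u₀ v₀ : ℝ) : NotPeriodicV (logMetric α β u₀ v₀) := by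
  intro u T hT
  simp only [logMetric_swap α β u₀ v₀]
  exact notPeriodicU_logMetric (by linarith) hβ hle v₀ u₀ u T hT

theorem properlyPeriodicV_logMetric {α β : ℝ} (h : 0 < α + β) (hβ : β ≠ 0) (hlt : β ^ 2 < α ^ 2)
    (u₀ v₀ : ℝ) : ProperlyPeriodicV (logMetric α β u₀ v₀) := by
  simp only [ProperlyPeriodicV, logMetric_swap α β u₀ v₀]
  exact properlyPeriodicU_logMetric (by linarith) hβ hlt v₀ u₀

theorem constantV_logMetric (α u₀ v₀ : ℝ) : ConstantV (logMetric α 0 u₀ v₀) := by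
  intro u v v'
  simp only [logMetric_swap α 0 u₀ v₀]
  exact constantU_logMetric α v₀ u₀ v v' u

end Metric

/-! ### Solving the Gauss equation under vanishing mixed derivative. -/

section MetricEquation

theorem dd_comp_linear {h : ℝ → ℝ} {h' : ℝ} (l : ℝ × ℝ →L[ℝ] ℝ) {p : ℝ × ℝ}
    (hh : HasDerivAt h h' (l p)) (a : ℝ × ℝ) : dd a (fun q => h (l q)) p = l a * h' := by
  have := hh.comp_hasFDerivAt p l.hasFDerivAt
  have h2 : fderiv ℝ (fun q => h (l q)) p = _ := this.fderiv
  rw [dd, h2]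
  simp [mul_comm]

/-- Solutions of `y'' = c y` in one of the variables on a connected open subset of the plane. -/
theorem exists_eq_gcosh_add_gsinh {U : Set (ℝ × ℝ)} (hU : IsOpen U) (hc : IsPreconnected U)
    (l : ℝ × ℝ →L[ℝ] ℝ) {c : ℝ} {f P : ℝ × ℝ → ℝ} (hf : Smooth U f) (hP : Smooth U P)
    (hdf : ∀ a : ℝ × ℝ, a = (1, 0) ∨ a = (0, 1) → ∀ p ∈ U, dd a f p = l a * P p)
    (hdP : ∀ a : ℝ × ℝ, a = (1, 0) ∨ a = (0, 1) → ∀ p ∈ U, dd a P p = l a * (c * f p)) :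
    ∃ a b : ℝ, ∀ p ∈ U, f p = a * gcosh c (l p) + b * gsinh c (l p) ∧
      P p = c * a * gsinh c (l p) + b * gcosh c (l p) := by
  rcases U.eq_empty_or_nonempty with rfl | ⟨p₀, hp₀⟩
  · exact ⟨0, 0, fun p hp => hp.elim⟩
  have hS : Smooth U fun q => gsinh c (l q) :=
    (ContDiff.comp (g := gsinh c) (contDiff_iff_contDiffAt.mpr fun x => (analyticAt_gsinh c x).contDiffAt)
      l.contDiff).contDiffOn
  have hC : Smooth U fun q => gcosh c (l q) :=
    (ContDiff.comp (g := gcosh c) (contDiff_iff_contDiffAt.mpr fun x => (analyticAt_gcosh c x).contDiffAt)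
      l.contDiff).contDiffOn
  -- The candidate coefficients arise by inverting the Wronskian matrix, whose determinant is
  -- `gcosh² - c gsinh² = 1`. Connectedness of `U` makes them global constants, even if lines meet
  -- `U` in several pieces.
  have ha : Smooth U fun q => f q * gcosh c (l q) - P q * gsinh c (l q) :=
    (hf.mul hC).sub (hP.mul hS)
  have hb : Smooth U fun q => P q * gcosh c (l q) - c * (f q * gsinh c (l q)) :=
    (hP.mul hC).sub (contDiffOn_const.mul (hf.mul hS))
  have hda : ∀ a : ℝ × ℝ, a = (1, 0) ∨ a = (0, 1) → ∀ p ∈ U,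
      dd a (fun q => f q * gcosh c (l q) - P q * gsinh c (l q)) p = 0 := by
    intro a ha p hp
    have h1 := hf.differentiableAt hU hp
    have h2 := hP.differentiableAt hU hp
    have h3 := hS.differentiableAt hU hp
    have h4 := hC.differentiableAt hU hp
    rw [dd_sub (h1.fun_mul h4) (h2.fun_mul h3), dd_mul h1 h4, dd_mul h2 h3, hdf a ha p hp,
      hdP a ha p hp, dd_comp_linear l (hasDerivAt_gsinh c _),
      dd_comp_linear l (hasDerivAt_gcosh c _)]
    ring
  have hdb : ∀ a : ℝ × ℝ, a = (1, 0) ∨ a = (0, 1) → ∀ p ∈ U,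
      dd a (fun q => P q * gcosh c (l q) - c * (f q * gsinh c (l q))) p = 0 := by
    intro a ha p hp
    have h1 := hf.differentiableAt hU hp
    have h2 := hP.differentiableAt hU hp
    have h3 := hS.differentiableAt hU hp
    have h4 := hC.differentiableAt hU hp
    rw [dd_sub (h2.fun_mul h4) ((h1.fun_mul h3).const_mul c), dd_mul h2 h4,
      dd_const_mul c (h1.fun_mul h3), dd_mul h1 h3, hdf a ha p hp,
      hdP a ha p hp, dd_comp_linear l (hasDerivAt_gsinh c _),
      dd_comp_linear l (hasDerivAt_gcosh c _)]
    ring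
  refine ⟨f p₀ * gcosh c (l p₀) - P p₀ * gsinh c (l p₀),
    P p₀ * gcosh c (l p₀) - c * (f p₀ * gsinh c (l p₀)), fun p hp => ?_⟩
  have e1 := eq_of_partials_eq_zero hU hc ha (hda _ (Or.inl rfl)) (hda _ (Or.inr rfl)) hp₀ hp
  have e2 := eq_of_partials_eq_zero hU hc hb (hdb _ (Or.inl rfl)) (hdb _ (Or.inr rfl)) hp₀ hp
  have hsq := gcosh_sq c (l p)
  rw [e1, e2]
  constructor
  · linear_combination (-f p) * hsq
  · linear_combination (-P p) * hsq

/-- A positive solution `r` of `r Δr = 1 + |∇r|²` with vanishing mixed derivative is one of the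
functions `metricFn α β`, up to a shift. -/
theorem exists_eq_metricFn {U : Set (ℝ × ℝ)} (hU : IsOpen U) (hc : IsConnected U)
    {r : ℝ × ℝ → ℝ} (hr : Smooth U r) (hpos : ∀ p ∈ U, 0 < r p)
    (hmix : ∀ p ∈ U, dd (1, 0) (dd (0, 1) r) p = 0)
    (hgauss : ∀ p ∈ U, r p * (dd (1, 0) (dd (1, 0) r) p + dd (0, 1) (dd (0, 1) r) p)
      = 1 + dd (1, 0) r p ^ 2 + dd (0, 1) r p ^ 2) :
    ∃ α β u₀ v₀ : ℝ, 0 < α + β ∧ ∀ p ∈ U, r p = metricFn α β (p.1 - u₀) (p.2 - v₀) := by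
  set f := dd (1, 0) r with hfdef
  set g := dd (0, 1) r with hgdef
  set P := dd (1, 0) f with hPdef
  set R := dd (0, 1) g with hRdef
  have hf : Smooth U f := hr.dd hU _
  have hg : Smooth U g := hr.dd hU _
  have hP : Smooth U P := hf.dd hU _
  have hR : Smooth U R := hg.dd hU _
  have hfv : ∀ p ∈ U, dd (0, 1) f p = 0 := fun p hp => by
    rw [hfdef, dd_comm hr hU _ _ hp]
    exact hmix p hp
  have hPv : ∀ p ∈ U, dd (0, 1) P p = 0 := fun p hp => by
    rw [hPdef, dd_comm hf hU _ _ hp]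
    exact dd_eq_zero_of_const hU hfv _ hp
  have hRu : ∀ p ∈ U, dd (1, 0) R p = 0 := fun p hp => by
    rw [hRdef, dd_comm hg hU _ _ hp]
    exact dd_eq_zero_of_const hU hmix _ hp
  have hdiff : ∀ {s : ℝ × ℝ → ℝ}, Smooth U s → ∀ {p}, p ∈ U → DifferentiableAt ℝ s p :=
    fun hs _ hp => hs.differentiableAt hU hp
  -- The Gauss equation differentiated in the direction `a`.
  have hgd : ∀ (a : ℝ × ℝ), ∀ p ∈ U, r p * (dd a P p + dd a R p) + (P p + R p) * dd a r p
      = 2 * f p * dd a f p + 2 * g p * dd a g p := by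
    intro a p hp
    have h := dd_congr hU hgauss a hp
    have hf2 : DifferentiableAt ℝ (fun q => f q ^ 2) p := (hdiff hf hp).pow 2
    have hg2 : DifferentiableAt ℝ (fun q => g q ^ 2) p := (hdiff hg hp).pow 2
    have h1 : DifferentiableAt ℝ (fun q => 1 + f q ^ 2) p := hf2.const_add 1
    rw [dd_mul (hdiff hr hp) ((hdiff hP hp).fun_add (hdiff hR hp)),
      dd_add (hdiff hP hp) (hdiff hR hp), dd_add h1 hg2,
      dd_add (differentiableAt_const 1) hf2, dd_const, dd_sq (hdiff hf hp),
      dd_sq (hdiff hg hp), zero_add] at h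
    exact h
  have hPu : ∀ p ∈ U, r p * dd (1, 0) P p = f p * (P p - R p) := fun p hp => by
    have h := hgd (1, 0) p hp
    rw [hRu p hp, hmix p hp, ← hfdef, ← hPdef] at h
    linear_combination h
  have hRv : ∀ p ∈ U, r p * dd (0, 1) R p = g p * (R p - P p) := fun p hp => by
    have h := hgd (0, 1) p hp
    rw [hPv p hp, hfv p hp, ← hgdef, ← hRdef] at h
    linear_combination h
  obtain ⟨p₀, hp₀⟩ := hc.nonempty
  have hinv : Smooth U fun q => (r q)⁻¹ := ContDiffOn.inv hr fun p hp => (hpos p hp).ne'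
  have hquot : Smooth U fun q => (r q)⁻¹ * (P q - R q) := hinv.mul (hP.sub hR)
  have hdquot : ∀ a : ℝ × ℝ, ∀ p ∈ U, r p ^ 2 * dd a (fun q => (r q)⁻¹ * (P q - R q)) p
      = r p * (dd a P p - dd a R p) - (P p - R p) * dd a r p := by
    intro a p hp
    have hne := (hpos p hp).ne'
    rw [dd_mul (hdiff hinv hp) ((hdiff hP hp).fun_sub (hdiff hR hp)),
      dd_sub (hdiff hP hp) (hdiff hR hp), dd_inv (hdiff hr hp) hne]
    field_simp
    ring
  -- By `hPu` and `hRv` the quotient `(P - R) / r` has zero gradient; its value is the separation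
  -- constant.
  obtain ⟨c, hcP⟩ : ∃ c : ℝ, ∀ p ∈ U, P p - R p = c * r p := by
    refine ⟨(r p₀)⁻¹ * (P p₀ - R p₀), fun p hp => ?_⟩
    have hne := (hpos p hp).ne'
    rw [eq_of_partials_eq_zero hU hc.isPreconnected hquot ?_ ?_ hp₀ hp]
    · field_simp
    · intro q hq
      have h := hdquot (1, 0) q hq
      rw [hRu q hq, sub_zero, hPu q hq, ← hfdef] at h
      refine (mul_eq_zero.mp (h.trans ?_)).resolve_left (pow_ne_zero 2 (hpos q hq).ne')
      ring
    · intro q hq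
      have h := hdquot (0, 1) q hq
      rw [hPv q hq, zero_sub, mul_neg, hRv q hq, ← hgdef] at h
      refine (mul_eq_zero.mp (h.trans ?_)).resolve_left (pow_ne_zero 2 (hpos q hq).ne')
      ring
  have hPc : ∀ p ∈ U, dd (1, 0) P p = c * f p := fun p hp => by
    apply mul_left_cancel₀ (hpos p hp).ne'
    rw [hPu p hp, hcP p hp]
    ring
  have hRc : ∀ p ∈ U, dd (0, 1) R p = -c * g p := fun p hp => by
    apply mul_left_cancel₀ (hpos p hp).ne'
    rw [hRv p hp, ← neg_sub, hcP p hp]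
    ring
  obtain ⟨a₁, b₁, h₁⟩ := exists_eq_gcosh_add_gsinh hU hc.isPreconnected
    (ContinuousLinearMap.fst ℝ ℝ ℝ) (c := c) hf hP
    (by rintro _ (rfl | rfl) p hp
        · simp [hPdef]
        · simp [hfv p hp])
    (by rintro _ (rfl | rfl) p hp
        · simp [hPc p hp]
        · simp [hPv p hp])
  obtain ⟨a₂, b₂, h₂⟩ := exists_eq_gcosh_add_gsinh hU hc.isPreconnected
    (ContinuousLinearMap.snd ℝ ℝ ℝ) (c := -c) hg hR
    (by rintro _ (rfl | rfl) p hp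
        · simp [hmix p hp]
        · simp [hRdef])
    (by rintro _ (rfl | rfl) p hp
        · simp [hRu p hp]
        · simp [hRc p hp])
  simp only [ContinuousLinearMap.coe_fst', ContinuousLinearMap.coe_snd'] at h₁ h₂
  have hden : ∀ p ∈ U, 0 < P p + R p := fun p hp => by
    refine pos_of_mul_pos_right ?_ (hpos p hp).le
    rw [hgauss p hp]
    positivity
  -- The first integrals of the two equations, evaluated at `p₀`.
  have hD : b₁ ^ 2 - c * a₁ ^ 2 = P p₀ ^ 2 - c * f p₀ ^ 2 := by
    rw [(h₁ p₀ hp₀).1, (h₁ p₀ hp₀).2]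
    linear_combination (c * a₁ ^ 2 - b₁ ^ 2) * gcosh_sq c p₀.1
  have hE : b₂ ^ 2 - -c * a₂ ^ 2 = R p₀ ^ 2 + c * g p₀ ^ 2 := by
    rw [(h₂ p₀ hp₀).1, (h₂ p₀ hp₀).2]
    linear_combination (-c * a₂ ^ 2 - b₂ ^ 2) * gcosh_sq (-c) p₀.2
  -- From `P² - R² = c r (P + R) = c (1 + f² + g²)`: the first integrals differ by exactly `c`.
  have hDE : (P p₀ ^ 2 - c * f p₀ ^ 2) - (R p₀ ^ 2 + c * g p₀ ^ 2) = c := by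
    linear_combination (P p₀ + R p₀) * hcP p₀ hp₀ + c * hgauss p₀ hp₀
  have hsum := hden p₀ hp₀
  -- A negative value would require `c > 0`; but then the other first integral is non-negative, and
  -- adding `c` to it gives a positive number.
  have hD0 : 0 ≤ P p₀ ^ 2 - c * f p₀ ^ 2 := by
    by_contra! hlt
    have hcpos : 0 < c := by
      by_contra! hle
      nlinarith [sq_nonneg (P p₀), mul_nonneg (neg_nonneg.mpr hle) (sq_nonneg (f p₀))]
    nlinarith [sq_nonneg (R p₀), mul_nonneg hcpos.le (sq_nonneg (g p₀))]
  have hE0 : 0 ≤ R p₀ ^ 2 + c * g p₀ ^ 2 := by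
    by_contra! hlt
    have hcneg : c < 0 := by
      by_contra! hle
      nlinarith [sq_nonneg (R p₀), mul_nonneg hle (sq_nonneg (g p₀))]
    nlinarith [sq_nonneg (P p₀), mul_nonneg (neg_pos.mpr hcneg).le (sq_nonneg (f p₀))]
  have hPR : c = 0 → P p₀ = R p₀ := fun h0 => by
    have := hcP p₀ hp₀
    rw [h0, zero_mul] at this
    linarith
  -- For `c > 0` the first integral is at least `c`, which excludes shifts of cosh and pure
  -- exponentials. For `c = 0`, `P = R` and `P + R > 0` exclude a constant `f`.
  obtain ⟨α, u₀, hα, ha₁, hb₁⟩ : ∃ α u₀ : ℝ, α ^ 2 = b₁ ^ 2 - c * a₁ ^ 2 ∧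
      a₁ = -α * gsinh c u₀ ∧ b₁ = α * gcosh c u₀ := by
    refine exists_shift (hD ▸ hD0) ?_
    rw [hD]
    rcases lt_trichotomy c 0 with h | h | h
    · exact Or.inl h
    · have h2 := hPR h
      right
      rw [h]
      have : 0 < P p₀ := by linarith
      simpa using pow_pos this 2
    · right
      linarith
  obtain ⟨β, v₀, hβ, ha₂, hb₂⟩ : ∃ β v₀ : ℝ, β ^ 2 = b₂ ^ 2 - -c * a₂ ^ 2 ∧
      a₂ = -β * gsinh (-c) v₀ ∧ b₂ = β * gcosh (-c) v₀ := by
    refine exists_shift (hE ▸ hE0) ?_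
    rw [hE]
    rcases lt_trichotomy c 0 with h | h | h
    · right
      linarith
    · have h2 := hPR h
      right
      rw [h]
      have : 0 < R p₀ := by linarith
      simpa using pow_pos this 2
    · exact Or.inl (by linarith)
  have hαβ : α ^ 2 - β ^ 2 = c := by rw [hα, hβ, hD, hE, hDE]
  have hβα : β ^ 2 - α ^ 2 = -c := by rw [← hαβ, neg_sub]
  have hfp : ∀ p ∈ U, f p = profile α β (p.1 - u₀) := fun p hp => by
    rw [profile_eq, hαβ, gsinh_sub, (h₁ p hp).1, ha₁, hb₁]
    ring
  have hgp : ∀ p ∈ U, g p = profile β α (p.2 - v₀) := fun p hp => by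
    rw [profile_eq, hβα, gsinh_sub, (h₂ p hp).1, ha₂, hb₂]
    ring
  have hdp : ∀ p ∈ U, P p + R p = metricDen α β (p.1 - u₀) (p.2 - v₀) := fun p hp => by
    rw [metricDen_eq, hαβ, hβα, gcosh_sub, gcosh_sub, (h₁ p hp).2, (h₂ p hp).2, ha₁, hb₁, ha₂, hb₂]
    ring
  refine ⟨α, β, u₀, v₀, pos_of_metricDen_pos (hdp p₀ hp₀ ▸ hsum), fun p hp => ?_⟩
  rw [metricFn, ← hfp p hp, ← hgp p hp, ← hdp p hp, eq_div_iff (hden p hp).ne', hgauss p hp]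

/-- The metric functions have vanishing mixed derivative. -/
theorem dd_dd_eq_zero_of_eq_metricFn {U : Set (ℝ × ℝ)} (hU : IsOpen U) {r : ℝ × ℝ → ℝ}
    (hr : Smooth U r) {α β u₀ v₀ : ℝ} (h : 0 < α + β)
    (hm : ∀ p ∈ U, r p = metricFn α β (p.1 - u₀) (p.2 - v₀)) {p : ℝ × ℝ} (hp : p ∈ U) :
    dd (1, 0) (dd (0, 1) r) p = 0 := by
  have key : ∀ q ∈ U, dd (0, 1) r q = profile β α (q.2 - v₀) := by
    intro q hq
    have hline : HasDerivAt (fun t : ℝ => (q.1, t)) ((0, 1) : ℝ × ℝ) q.2 :=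
      (hasDerivAt_const q.2 q.1).prodMk (hasDerivAt_id q.2)
    have h1 : HasDerivAt (fun t : ℝ => r (q.1, t)) (dd (0, 1) r q) q.2 :=
      (hr.differentiableAt hU hq).hasFDerivAt.comp_hasDerivAt q.2 hline
    have h2 := (hasDerivAt_metricFn_right h (q.1 - u₀) (q.2 - v₀)).comp_sub_const q.2 v₀
    refine h1.unique (h2.congr_of_eventuallyEq ?_)
    have hmem : (fun t : ℝ => (q.1, t)) ⁻¹' U ∈ nhds q.2 :=
      hline.continuousAt.preimage_mem_nhds (hU.mem_nhds hq)
    filter_upwards [hmem] with t ht using hm _ ht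
  rw [dd_congr hU key _ hp]
  have := dd_comp_linear (ContinuousLinearMap.snd ℝ ℝ ℝ)
    (((hasDerivAt_profile β α (p.2 - v₀)).comp_sub_const p.2 v₀)) (1, 0)
  simpa using this

end MetricEquation

/-! ### Isothermic minimal surfaces and the main theorem. -/

theorem IsIsothermicMinimal.principalFrame {U : Set (ℝ × ℝ)} {X N : ℝ × ℝ → E3} {ω : ℝ × ℝ → ℝ}
    (hX : IsIsothermicMinimal U X N ω) :
    PrincipalFrame U X N (fun p => Real.exp (ω p)) (fun p => ⟪pu (pu X) p, N p⟫)
      (1, 0) (0, 1) := by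
  have hU := hX.isOpen
  have hsX : Smooth U X := hX.smooth
  have hsN : Smooth U N := hX.smooth_normal
  have hdN : ∀ {p}, p ∈ U → DifferentiableAt ℝ N p := fun hp => hsN.differentiableAt hU hp
  have hdX : ∀ {p}, p ∈ U → ∀ a, DifferentiableAt ℝ (dd a X) p :=
    fun hp a => (hsX.dd hU a).differentiableAt hU hp
  have hexp : ∀ p, Real.exp (2 * ω p) = Real.exp (ω p) ^ 2 := fun p => by
    rw [← Real.exp_nat_mul]; norm_num
  have hm : ∀ p ∈ U, ⟪dd (1, 0) X p, dd (1, 0) X p⟫ = Real.exp (ω p) ^ 2 :=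
    fun p hp => (hX.metric_uu p hp).trans (hexp p)
  have hm' : ∀ p ∈ U, ⟪dd (0, 1) X p, dd (0, 1) X p⟫ = Real.exp (ω p) ^ 2 :=
    fun p hp => (hX.metric_vv p hp).trans (hexp p)
  have hnu : ∀ p ∈ U, ⟪N p, dd (1, 0) X p⟫ = 0 := hX.normal_u
  have hnv : ∀ p ∈ U, ⟪N p, dd (0, 1) X p⟫ = 0 := hX.normal_v
  have hvv : ∀ p ∈ U, ⟪dd (0, 1) (dd (0, 1) X) p, N p⟫ = -⟪dd (1, 0) (dd (1, 0) X) p, N p⟫ := by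
    intro p hp
    have h1 : 1 / (2 * Real.exp (2 * ω p)) *
      ⟪dd (1, 0) (dd (1, 0) X) p + dd (0, 1) (dd (0, 1) X) p, N p⟫ = 0 := hX.minimal p hp
    have h2 := (mul_eq_zero.mp h1).resolve_left (by positivity)
    rw [inner_add_left] at h2
    linarith
  refine
    { isOpen := hU
      smooth := hsX
      smooth_normal := hsN
      smooth_factor := ?_
      pos := fun p _ => Real.exp_pos _
      metric := hm
      metric' := hm'
      metric_mixed := hX.metric_uv
      norm_normal := hX.norm_normal
      normal := hnu
      normal' := hnv
      weingarten := ?_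
      weingarten' := ?_ }
  · have h1 : Smooth U fun p => √⟪dd (1, 0) X p, dd (1, 0) X p⟫ :=
      (ContDiffOn.inner ℝ (hsX.dd hU _) (hsX.dd hU _)).sqrt fun p hp => by
        rw [hm p hp]
        positivity
    refine ContDiffOn.congr h1 fun p hp => ?_
    rw [hm p hp, Real.sqrt_sq (Real.exp_pos _).le]
  · intro p hp
    obtain ⟨k, hk⟩ := hX.principal_u p hp
    have hk' : dd (1, 0) N p = -k • dd (1, 0) X p := hk
    have h := dd_eq_zero_of_const hU hnu (1, 0) hp
    rw [dd_inner (hdN hp) (hdX hp _), hk', inner_smul_left, hm p hp, real_inner_comm] at h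
    have h2 : ⟪pu (pu X) p, N p⟫ = k * Real.exp (ω p) ^ 2 := by
      simp only [map_neg, conj_trivial] at h
      change ⟪dd (1, 0) (dd (1, 0) X) p, N p⟫ = _
      linarith
    rw [hk', h2, mul_div_cancel_right₀ _ (by positivity)]
  · intro p hp
    obtain ⟨k, hk⟩ := hX.principal_v p hp
    have hk' : dd (0, 1) N p = -k • dd (0, 1) X p := hk
    have h := dd_eq_zero_of_const hU hnv (0, 1) hp
    rw [dd_inner (hdN hp) (hdX hp _), hk', inner_smul_left, hm' p hp, real_inner_comm,
      hvv p hp] at h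
    have h2 : ⟪pu (pu X) p, N p⟫ = -k * Real.exp (ω p) ^ 2 := by
      simp only [map_neg, conj_trivial] at h
      change ⟪dd (1, 0) (dd (1, 0) X) p, N p⟫ = _
      linarith
    rw [hk', h2, mul_div_cancel_right₀ _ (by positivity)]

theorem IsIsothermicMinimal.hopf_eq {U : Set (ℝ × ℝ)} {X N : ℝ × ℝ → E3} {ω : ℝ × ℝ → ℝ}
    (hX : IsIsothermicMinimal U X N ω) {p : ℝ × ℝ} (hp : p ∈ U) :
    hopf X N p = ((⟪pu (pu X) p, N p⟫ / 2 : ℝ) : ℂ) := by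
  have h1 : ⟪pv (pu X) p, N p⟫ = 0 := hX.principalFrame.inner_mixed_normal hp
  have h2 : ⟪pv (pv X) p, N p⟫ = -⟪pu (pu X) p, N p⟫ := hX.principalFrame.swap.inner_normal hp
  rw [hopf, h1, h2]
  push_cast
  ring

/-- Planarity of the `u`-lines alone already forces `r_uv = 0`. Conversely `r_uv = r_vu`, so the
swapped frame yields the `v`-lines. -/
theorem hasPlanarCurvatureLines_iff {U : Set (ℝ × ℝ)} {X N : ℝ × ℝ → E3} {r L : ℝ × ℝ → ℝ}
    (F : PrincipalFrame U X N r L (1, 0) (0, 1)) {l : ℝ} (hl : l ^ 2 = 1)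
    (hL : ∀ p ∈ U, L p = l) :
    HasPlanarCurvatureLines U X ↔ ∀ p ∈ U, dd (1, 0) (dd (0, 1) r) p = 0 := by
  constructor
  · intro h p hp
    refine F.dd_eq_zero_of_coplanar hl hL (fun q I hI hIU => ?_) hp
    have hq : ∀ t : ℝ, q + t • ((1, 0) : ℝ × ℝ) = (q.1 + t, q.2) := fun t => by
      ext <;> simp
    simp only [hq] at hIU ⊢
    have hI' : ((fun t => t - q.1) ⁻¹' I).OrdConnected :=
      hI.preimage_mono fun a b hab => sub_le_sub_right hab _
    have := h.1 q.2 _ hI' fun u hu => by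
      have := hIU (u - q.1) hu
      rwa [add_sub_cancel] at this
    convert this using 1
    ext x
    constructor
    · rintro ⟨t, ht, rfl⟩
      exact ⟨q.1 + t, by simpa using ht, rfl⟩
    · rintro ⟨u, hu, rfl⟩
      exact ⟨u - q.1, hu, by simp⟩
  · intro h
    constructor
    · intro v I hI hIU
      have hq : ∀ t : ℝ, ((0, v) : ℝ × ℝ) + t • ((1, 0) : ℝ × ℝ) = (t, v) := fun t => by
        ext <;> simp
      have := F.coplanar_of_dd_eq_zero hl hL h (0, v) hI fun t ht => by
        rw [hq]
        exact hIU t ht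
      simpa only [hq] using this
    · intro u J hJ hJU
      have hq : ∀ t : ℝ, ((u, 0) : ℝ × ℝ) + t • ((0, 1) : ℝ × ℝ) = (u, t) := fun t => by
        ext <;> simp
      have := F.swap.coplanar_of_dd_eq_zero (l := -l) (by rw [neg_sq, hl])
        (fun p hp => by rw [hL p hp])
        (fun p hp => by
          rw [dd_comm F.smooth_factor F.isOpen _ _ hp]
          exact h p hp) (u, 0) hJ fun t ht => by
            rw [hq]
            exact hJU t ht
      simpa only [hq] using this

theorem theorem2p6 (U : Set (ℝ × ℝ)) (X N : ℝ × ℝ → E3) (ω : ℝ × ℝ → ℝ)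
    (hX : IsIsothermicMinimal U X N ω) (hnp : ¬ Coplanar ℝ (X '' U)) :
    -- the Hopf differential is a nonzero real constant, so that it can be normalized
    (∃ q : ℝ, q ≠ 0 ∧ ∀ p ∈ U, hopf X N p = (q : ℂ)) ∧
    -- with the normalization `Q = -1/2`: the characterization of planar curvature lines
    ((∀ p ∈ U, hopf X N p = -1 / 2) →
      (HasPlanarCurvatureLines U X ↔
        ∃ α β u₀ v₀ : ℝ, 0 < α + β ∧
          ∀ u v : ℝ, (u, v) ∈ U → Real.exp (ω (u, v)) = metricFn α β (u - u₀) (v - v₀))) ∧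
    -- the metric function on the whole plane, and its behaviour in the two directions
    (∀ α β u₀ v₀ : ℝ, 0 < α + β →
      (∀ u v : ℝ, 0 < metricDen α β u v) ∧
      ∃ Ω : ℝ × ℝ → ℝ, AnalyticOnNhd ℝ Ω Set.univ ∧
        (∀ u v : ℝ, Real.exp (Ω (u, v)) = metricFn α β (u - u₀) (v - v₀)) ∧
        ((∀ u v : ℝ, (u, v) ∈ U → Real.exp (ω (u, v)) = metricFn α β (u - u₀) (v - v₀)) →
          Set.EqOn Ω ω U) ∧
        (|β| < α ∧ β ≠ 0 → NotPeriodicU Ω ∧ ProperlyPeriodicV Ω) ∧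
        (0 < α ∧ β = 0 → NotPeriodicU Ω ∧ ConstantV Ω) ∧
        (α = β → NotPeriodicU Ω ∧ NotPeriodicV Ω) ∧
        (|α| < β ∧ α ≠ 0 → ProperlyPeriodicU Ω ∧ NotPeriodicV Ω) ∧
        (α = 0 ∧ 0 < β → ConstantU Ω ∧ NotPeriodicV Ω)) := by
  have F := hX.principalFrame
  have hc := hX.isConnected
  refine ⟨?_, ?_, ?_⟩
  · obtain ⟨p₀, hp₀⟩ := hc.nonempty
    have hconst : ∀ p ∈ U, ⟪pu (pu X) p, N p⟫ = ⟪pu (pu X) p₀, N p₀⟫ := fun p hp =>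
      F.curvature_const hc.isPreconnected hp hp₀
    refine ⟨⟪pu (pu X) p₀, N p₀⟫ / 2, fun h0 => hnp ?_, fun p hp => ?_⟩
    · refine F.coplanar_of_curvature_eq_zero hc.isPreconnected fun p hp => ?_
      rw [hconst p hp]
      linarith
    · rw [hX.hopf_eq hp, hconst p hp]
  · intro hQ
    -- `L = 2 Q = -1`, so `l² = 1` holds and the constant in the Gauss equation is `1`.
    have hL : ∀ p ∈ U, ⟪pu (pu X) p, N p⟫ = (-1 : ℝ) := fun p hp => by
      have h1 := (hX.hopf_eq hp).symm.trans (hQ p hp)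
      have h2 : ⟪pu (pu X) p, N p⟫ / 2 = (-1 / 2 : ℝ) := by
        apply Complex.ofReal_injective
        rw [h1]
        push_cast
        ring
      linarith
    rw [hasPlanarCurvatureLines_iff F (by norm_num) hL]
    constructor
    · intro hmix
      obtain ⟨α, β, u₀, v₀, h, hm⟩ := exists_eq_metricFn F.isOpen hc F.smooth_factor F.pos hmix
        fun p hp => by
          have := F.gauss hp
          rwa [hL p hp, neg_one_sq] at this
      exact ⟨α, β, u₀, v₀, h, fun u v huv => hm (u, v) huv⟩
    · rintro ⟨α, β, u₀, v₀, h, hm⟩ p hp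
      exact dd_dd_eq_zero_of_eq_metricFn F.isOpen F.smooth_factor h (fun q hq => hm q.1 q.2 hq) hp
  · intro α β u₀ v₀ h
    refine ⟨metricDen_pos h, logMetric α β u₀ v₀, analyticOnNhd_log_metricFn h u₀ v₀,
      exp_logMetric h u₀ v₀, ?_, ?_, ?_, ?_, ?_, ?_⟩
    · rintro hω ⟨u, v⟩ huv
      exact Real.exp_injective ((exp_logMetric h u₀ v₀ u v).trans (hω u v huv).symm)
    · rintro ⟨hlt, hβ⟩
      have hsq : β ^ 2 < α ^ 2 := sq_lt_sq' (by linarith [neg_abs_le β]) (by linarith [le_abs_self β])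
      exact ⟨notPeriodicU_logMetric h ((abs_nonneg β).trans_lt hlt).ne' hsq.le u₀ v₀,
        properlyPeriodicV_logMetric h hβ hsq u₀ v₀⟩
    · rintro ⟨hα, rfl⟩
      exact ⟨notPeriodicU_logMetric h hα.ne' (by simpa using sq_nonneg α) u₀ v₀, constantV_logMetric α u₀ v₀⟩
    · rintro rfl
      have hα : α ≠ 0 := by
        rintro rfl
        simp at h
      exact ⟨notPeriodicU_logMetric h hα le_rfl u₀ v₀, notPeriodicV_logMetric h hα le_rfl u₀ v₀⟩
    · rintro ⟨hlt, hα⟩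
      have hsq : α ^ 2 < β ^ 2 := sq_lt_sq' (by linarith [neg_abs_le α]) (by linarith [le_abs_self α])
      exact ⟨properlyPeriodicU_logMetric h hα hsq u₀ v₀,
        notPeriodicV_logMetric h ((abs_nonneg α).trans_lt hlt).ne' hsq.le u₀ v₀⟩
    · rintro ⟨rfl, hβ⟩
      exact ⟨constantU_logMetric β u₀ v₀,
        notPeriodicV_logMetric h hβ.ne' (by simpa using sq_nonneg β) u₀ v₀⟩
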